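/- Let $H\in(0,\tfrac12)$, $\gamma\in(0,1]$, $T>0$, $M<2$ and $C_0,C_1>0$. Let $W=\{W(t,x):t\in\mathbb R,\ x\in\mathbb R^d\}$ be a jointly measurable, mean zero Gaussian random field on a probability space $(\Omega,\mathcal F,P)$ with covariance $$E[W(t,x)W(s,y)]=\tfrac12\bigl(|t|^{2H}+|s|^{2H}-|t-s|^{2H}\bigr)Q(x,y),$$ where $Q:\mathbb R^d\times\mathbb R^d\to\mathbb R$ satisfies, for every $K>0$ and all $x,y,u,v\in\mathbb R^d$ of norm at most $K$, $$\text{(Q1)}\ \ Q(x,y)\le C_0(1+K)^M,\qquad \text{(Q2)}\ \ |Q(x,y)-Q(u,v)|\le C_1(1+K)^M\bigl(|x-u|^\gamma+|y-v|^\gamma\bigr).$$ For $\varepsilon>0$ put $\dot W^\varepsilon(s,x)=\frac1{2\varepsilon}\bigl(W(s+\varepsilon,x)-W(s-\varepsilon,x)\bigr)$. For a continuous $\phi:[0,T]\to\mathbb R^d$ and $t\in[0,T]$, the nonlinear stochastic integral $\int_0^tW(ds,\phi_s)$ is defined as the limit in $L^2(\Omega)$ of $\int_0^t\dot W^\varepsilon(s,\phi_s)\,ds$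 as $\varepsilon\downarrow0$, if this limit exists. Let $\alpha\in(0,1]$ with $\gamma\alpha>1-2H$ and let $\phi\in C^\alpha([0,T];\mathbb R^d)$. Then, for every $t\in[0,T]$, the approximations $\int_0^t\dot W^\varepsilon(s,\phi_s)\,ds$, $\varepsilon>0$, are almost surely well defined and belong to $L^2(\Omega)$, the integral $\int_0^tW(ds,\phi_s)$ exists, and $$E\Bigl(\int_0^tW(ds,\phi_s)\Bigr)^2=2H\int_0^t\theta^{2H-1}Q(\phi_\theta,\phi_\theta)\,d\theta+2H(2H-1)\int_0^t\int_0^\theta r^{2H-2}\bigl(Q(\phi_\theta,\phi_{\theta-r})-Q(\phi_\theta,\phi_\theta)\bigr)\,dr\,d\theta,$$ where all the (iterated) integrals on the right converge absolutely. Furthermore, for every $\alpha'$ with $\frac{1-2H}{\gamma}<\alpha'<\alpha$ there is a constant $C$, depending only on $H,T,\gamma,\alpha,\alpha',C_0,C_1$, such that for all $\varepsilon>0$ $$\sup_{0\le t\le T}E\Bigl(\Bigl|\int_0^t\dot W^\varepsilon(s,\phi_s)\,ds-\int_0^tW(ds,\phi_s)\Bigr|^2\Bigr)\le C\,(1+\|\phi\|_\infty)^M\,(1+\|\phi\|_\alpha^\gamma)\,\varepsilon^{2H+\gamma\alpha'-1},$$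 where $\|\phi\|_\infty=\sup_{0\le s\le T}|\phi_s|$ and $\|\phi\|_\alpha=\sup_{0\le s<t\le T}|\phi_t-\phi_s|/|t-s|^\alpha$. -/

import Mathlib

open MeasureTheory ProbabilityTheory Filter Topology Set
open scoped NNReal ENNReal

universe u

/-- The covariance function of the two-sided fractional Brownian motion of Hurst parameter `H`. -/
noncomputable def fbmCov (H t s : ℝ) : ℝ :=
  (|t| ^ (2 * H) + |s| ^ (2 * H) - |t - s| ^ (2 * H)) / 2

/-- Local boundedness of the spatial covariance, with constants `C₀` and `M`. -/
def SpatialBound {d : ℕ} (C₀ M : ℝ)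
    (Q : EuclideanSpace ℝ (Fin d) → EuclideanSpace ℝ (Fin d) → ℝ) : Prop :=
  ∀ K : ℝ, 0 < K → ∀ x y : EuclideanSpace ℝ (Fin d), ‖x‖ ≤ K → ‖y‖ ≤ K →
    Q x y ≤ C₀ * (1 + K) ^ M

/-- Local `γ`-Hölder continuity of the spatial covariance, with constants `C₁` and `M`. -/
def SpatialHolder {d : ℕ} (γ C₁ M : ℝ)
    (Q : EuclideanSpace ℝ (Fin d) → EuclideanSpace ℝ (Fin d) → ℝ) : Prop :=
  ∀ K : ℝ, 0 < K → ∀ x y u v : EuclideanSpace ℝ (Fin d),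
    ‖x‖ ≤ K → ‖y‖ ≤ K → ‖u‖ ≤ K → ‖v‖ ≤ K →
    |Q x y - Q u v| ≤ C₁ * (1 + K) ^ M * (‖x - u‖ ^ γ + ‖y - v‖ ^ γ)

/-- `W = {W(t, x) : t ∈ ℝ, x ∈ ℝᵈ}` is a (jointly measurable) centred Gaussian random field with
covariance `E[W(t, x) W(s, y)] = R_H(t, s) Q(x, y)`, where the spatial covariance `Q` is locally
bounded and locally `γ`-Hölder continuous, with growth exponent `M < 2`. -/
structure IsFractionalField {d : ℕ} {Ω : Type u} [MeasurableSpace Ω] (P : Measure Ω)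
    (H γ M C₀ C₁ : ℝ) (Q : EuclideanSpace ℝ (Fin d) → EuclideanSpace ℝ (Fin d) → ℝ)
    (W : ℝ → EuclideanSpace ℝ (Fin d) → Ω → ℝ) : Prop where
  measurable : Measurable (fun p : (ℝ × EuclideanSpace ℝ (Fin d)) × Ω => W p.1.1 p.1.2 p.2)
  gaussian : IsGaussianProcess (fun p : ℝ × EuclideanSpace ℝ (Fin d) => W p.1 p.2) P
  mean_zero : ∀ t x, ∫ ω, W t x ω ∂P = 0
  covariance : ∀ t s x y, ∫ ω, W t x ω * W s y ω ∂P = fbmCov H t s * Q x y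
  growth_lt : M < 2
  bound : SpatialBound C₀ M Q
  holder : SpatialHolder γ C₁ M Q

/-- The symmetric difference quotient in time `(W(s + ε, x) - W(s - ε, x)) / (2 ε)`. -/
noncomputable def symmQuot {d : ℕ} {Ω : Type u} (W : ℝ → EuclideanSpace ℝ (Fin d) → Ω → ℝ)
    (ε s : ℝ) (x : EuclideanSpace ℝ (Fin d)) (ω : Ω) : ℝ :=
  (W (s + ε) x ω - W (s - ε) x ω) / (2 * ε)

/-- The symmetric approximation `∫₀ᵗ (W(s + ε, φ s) - W(s - ε, φ s)) / (2 ε) ds`, a pathwise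
Lebesgue integral. -/
noncomputable def symmApprox {d : ℕ} {Ω : Type u} (W : ℝ → EuclideanSpace ℝ (Fin d) → Ω → ℝ)
    (φ : ℝ → EuclideanSpace ℝ (Fin d)) (ε t : ℝ) (ω : Ω) : ℝ :=
  ∫ s in (0 : ℝ)..t, symmQuot W ε s (φ s) ω

/-- The random variable `I` is (a version of) the nonlinear stochastic integral `∫₀ᵗ W(ds, φ s)`:
the limit in `L²(Ω)` of the symmetric approximations as `ε ↓ 0`. -/
def IsNonlinearIntegral {d : ℕ} {Ω : Type u} [MeasurableSpace Ω] (P : Measure Ω)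
    (W : ℝ → EuclideanSpace ℝ (Fin d) → Ω → ℝ) (φ : ℝ → EuclideanSpace ℝ (Fin d)) (t : ℝ)
    (I : Ω → ℝ) : Prop :=
  MemLp I 2 P ∧
  (∀ᶠ ε in 𝓝[>] (0 : ℝ), MemLp (symmApprox W φ ε t) 2 P) ∧
  Tendsto (fun ε : ℝ => eLpNorm (fun ω => symmApprox W φ ε t ω - I ω) 2 P) (𝓝[>] (0 : ℝ)) (𝓝 0)

/-- The supremum norm of `φ` on `[0, T]`. -/
noncomputable def supNormOn {d : ℕ} (T : ℝ) (φ : ℝ → EuclideanSpace ℝ (Fin d)) : ℝ :=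
  ⨆ s : Icc (0 : ℝ) T, ‖φ s‖

/-- `φ ∈ C^α([0, T])`. -/
def HolderOnInterval {d : ℕ} (α : ℝ≥0) (T : ℝ) (φ : ℝ → EuclideanSpace ℝ (Fin d)) : Prop :=
  MemHolder α ((Icc (0 : ℝ) T).domRestrict φ)

/-- The `α`-Hölder seminorm of `φ` on `[0, T]`. -/
noncomputable def holderSeminormOn {d : ℕ} (α : ℝ≥0) (T : ℝ)
    (φ : ℝ → EuclideanSpace ℝ (Fin d)) : ℝ :=
  nnHolderNorm α ((Icc (0 : ℝ) T).domRestrict φ)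

/-! Write `a = 2H` and `q s r = Q (φ s) (φ r)`. By Fubini the approximations with steps `ε` and `δ`
have inner product `∫∫ K (s - r) q s r` over `[0, t]²`, where `K = quotCov a ε δ` is a mixed second
difference quotient of `|u| ^ a / 2`. Folding the square onto a triangle and subtracting the
diagonal gives `∫_θ ∫_{r<θ} 2K(r) (q θ (θ - r) - q θ θ) + ∫_θ q θ θ ∫_{r<θ} 2K(r)`. Formally `2K(r)`
tends to `a(a-1) r^(a-2)` and its primitive to `a θ^(a-1)`, which yields the variance formula. The
power `r^(a-2)` is not integrable at `0`, but it only meets the increment of `q`, which is `O(r^β)`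
for `β ≤ γα`, and `a + β > 1`.

The analytic core is a pair of weighted `L¹` estimates,
`exists_integral_abs_quotCov_sub_mul_rpow_le` and `exists_integral_abs_integral_quotCov_sub_le`:
both kernel errors are `O(ε^(a+β-1))`, uniformly in `δ ≤ ε`. For `r ≥ 4ε` they follow from the mean
value theorem; for `r ≤ 4ε` the kernel and its limit are bounded separately.

Thus all inner products of two approximations lie within `E₀ ε^ρ` of one number `L`, with `ρ = a + β
- 1 > 0` and `ε` the larger step. In a Hilbert space this alone gives the Cauchy property, the
squared norm `L` of the limit, and the rate `4 E₀ ε^ρ` for the squared distance. -/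

/-! ### Pointwise estimates for the covariance kernel -/

/-- The covariance of the symmetric difference quotients, with steps `ε` and `δ`, of a fractional
Brownian motion of Hurst parameter `a / 2` at two times at distance `u`. -/
noncomputable def quotCov (a ε δ u : ℝ) : ℝ :=
  (|u + ε + δ| ^ a + |u - ε - δ| ^ a - |u + ε - δ| ^ a - |u - ε + δ| ^ a) / (8 * ε * δ)

theorem quotCov_neg (a ε δ u : ℝ) : quotCov a ε δ (-u) = quotCov a ε δ u := by
  unfold quotCov
  rw [← abs_neg (-u + ε + δ), ← abs_neg (-u - ε - δ), ← abs_neg (-u + ε - δ),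
    ← abs_neg (-u - ε + δ)]
  ring_nf

theorem continuous_quotCov {a : ℝ} (ha : 0 < a) (ε δ : ℝ) : Continuous (quotCov a ε δ) := by
  have h : ∀ c d : ℝ, Continuous fun u : ℝ => |u + c + d| ^ a := fun c d =>
    Continuous.rpow_const (by fun_prop) fun _ => Or.inr ha.le
  have h1 := h ε δ
  have h2 := h (-ε) (-δ)
  have h3 := h ε (-δ)
  have h4 := h (-ε) δ
  simp only [← sub_eq_add_neg] at h2 h3 h4
  exact (((h1.add h2).sub h3).sub h4).div_const _

/-- Writing `z ^ a = z * z ^ (a - 1)`, the claim reduces to `x ^ (a - 1) ≤ y ^ (a - 1)`, as the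
exponent is nonpositive. -/
theorem rpow_sub_rpow_le_sub_mul {a x y : ℝ} (ha0 : 0 < a) (ha1 : a ≤ 1) (hy : 0 ≤ y)
    (hyx : y ≤ x) (hx : 0 < x) : x ^ a - y ^ a ≤ (x - y) * x ^ (a - 1) := by
  have e : ∀ z : ℝ, 0 < z → z ^ a = z * z ^ (a - 1) := fun z hz => by
    rw [← Real.rpow_one_add' hz.le (by linarith)]; congr 1; ring
  rcases hy.eq_or_lt with rfl | hy
  · rw [Real.zero_rpow ha0.ne', e x hx]; simp
  · rw [e x hx, e y hy]
    have : x ^ (a - 1) ≤ y ^ (a - 1) := Real.rpow_le_rpow_of_nonpos hy hyx (by linarith)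
    nlinarith

/-- There is no restriction on `δ` relative to `v`: for `v > 0` the bases `v + δ` and `|v - δ|`
differ by at most `2δ`, and the larger one is at least `v`. -/
theorem abs_symm_rpow_sub_le {a v δ : ℝ} (ha0 : 0 < a) (ha1 : a ≤ 1) (hδ : 0 < δ) (hv : v ≠ 0) :
    |(|v + δ| ^ a - |v - δ| ^ a)| ≤ 2 * δ * |v| ^ (a - 1) := by
  wlog hv0 : 0 < v generalizing v
  · have := this (v := -v) (by simpa using hv) (by
      rcases lt_or_gt_of_ne hv with h | h
      · linarith
      · exact absurd h hv0)
    rw [abs_neg, ← abs_neg (-v + δ), ← abs_neg (-v - δ), abs_sub_comm] at this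
    convert this using 4 <;> ring_nf
  have h1 : |v - δ| ≤ v + δ := abs_le.2 ⟨by linarith, by linarith⟩
  rw [abs_of_pos (by linarith : 0 < v + δ), abs_of_pos hv0, abs_of_nonneg
    (sub_nonneg.2 (Real.rpow_le_rpow (abs_nonneg _) h1 ha0.le))]
  refine (rpow_sub_rpow_le_sub_mul ha0 ha1 (abs_nonneg _) h1 (by linarith)).trans ?_
  have h2 : (v + δ) ^ (a - 1) ≤ v ^ (a - 1) :=
    Real.rpow_le_rpow_of_nonpos hv0 (by linarith) (by linarith)
  have h3 : v + δ - |v - δ| ≤ 2 * δ := by linarith [le_abs_self (v - δ)]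
  exact mul_le_mul h3 h2 (by positivity) (by positivity)

/-- The kernel is a difference in `ε` of symmetric differences in `δ`. Bounding each of the latter
by a multiple of `δ` cancels the `δ` in the denominator, so the bound near the diagonal does not see
`δ`. -/
theorem abs_quotCov_le {a ε δ u : ℝ} (ha0 : 0 < a) (ha1 : a ≤ 1) (hε : 0 < ε) (hδ : 0 < δ)
    (h1 : u + ε ≠ 0) (h2 : u - ε ≠ 0) :
    |2 * quotCov a ε δ u| ≤ (|u + ε| ^ (a - 1) + |u - ε| ^ (a - 1)) / (2 * ε) := by
  have e1 := abs_symm_rpow_sub_le ha0 ha1 hδ h1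
  have e2 := abs_symm_rpow_sub_le ha0 ha1 hδ h2
  have : 2 * quotCov a ε δ u = ((|u + ε + δ| ^ a - |u + ε - δ| ^ a) -
      (|u - ε + δ| ^ a - |u - ε - δ| ^ a)) / (4 * ε * δ) := by
    unfold quotCov; field_simp; ring
  rw [this, abs_div, abs_of_pos (by positivity : 0 < 4 * ε * δ), div_le_div_iff₀ (by positivity)
    (by positivity)]
  have := (abs_sub (|u + ε + δ| ^ a - |u + ε - δ| ^ a)
      (|u - ε + δ| ^ a - |u - ε - δ| ^ a)).trans (add_le_add e1 e2)
  calc _ ≤ (2 * δ * |u + ε| ^ (a - 1) + 2 * δ * |u - ε| ^ (a - 1)) * (2 * ε) := by gcongr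
    _ = _ := by ring

/-- Two applications of the mean value theorem: to `v ↦ (v + δ) ^ p - (v - δ) ^ p` on `[u - ε, u +
ε]`, then to the power `p - 1` on `[η - δ, η + δ]`. -/
theorem exists_second_difference_rpow_eq (p : ℝ) {ε δ u : ℝ} (hε : 0 < ε) (hδ : 0 < δ)
    (hu : ε + δ < u) : ∃ ξ, |ξ - u| ≤ ε + δ ∧
      ((u + ε + δ) ^ p + (u - ε - δ) ^ p - (u + ε - δ) ^ p - (u - ε + δ) ^ p) / (4 * ε * δ) =
        p * (p - 1) * ξ ^ (p - 2) := by
  have hd : ∀ q x : ℝ, 0 < x → HasDerivAt (fun x : ℝ => x ^ q) (q * x ^ (q - 1)) x :=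
    fun q x hx => Real.hasDerivAt_rpow_const (Or.inl hx.ne')
  have hD : ∀ v, δ < v → HasDerivAt (fun v : ℝ => (v + δ) ^ p - (v - δ) ^ p)
      (p * (v + δ) ^ (p - 1) - p * (v - δ) ^ (p - 1)) v := fun v hv =>
    ((hd p (v + δ) (by linarith)).comp_add_const v δ).sub
      ((hd p (v - δ) (by linarith)).comp_sub_const v δ)
  obtain ⟨η, hη, e1⟩ := exists_hasDerivAt_eq_slope _ _ (by linarith : u - ε < u + ε)
    (fun v hv => (hD v (by linarith [hv.1])).continuousAt.continuousWithinAt)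
    (fun v hv => hD v (by linarith [hv.1]))
  obtain ⟨ξ, hξ, e2⟩ := exists_hasDerivAt_eq_slope _ _ (by linarith : η - δ < η + δ)
    (fun v hv => (hd (p - 1) v (by linarith [hv.1, hη.1])).continuousAt.continuousWithinAt)
    (fun v hv => hd (p - 1) v (by linarith [hv.1, hη.1]))
  refine ⟨ξ, abs_le.2 ⟨by linarith [hξ.1, hη.1], by linarith [hξ.2, hη.2]⟩, ?_⟩
  have e2' : (p - 1) * ξ ^ (p - 2) * (2 * δ) = (η + δ) ^ (p - 1) - (η - δ) ^ (p - 1) := by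
    rw [show p - 2 = p - 1 - 1 by ring, e2, show η + δ - (η - δ) = 2 * δ by ring,
      div_mul_cancel₀ _ (by positivity)]
  rw [div_eq_iff (by positivity)]
  rw [eq_div_iff (by linarith)] at e1
  calc _ = _ := by rw [show ∀ x y z w : ℝ, x + y - z - w = x - z - (w - y) by intros; ring]
    _ = _ := e1.symm
    _ = p * ((η + δ) ^ (p - 1) - (η - δ) ^ (p - 1)) * (2 * ε) := by ring
    _ = _ := by rw [← e2']; ring

theorem abs_second_difference_rpow_sub_le {p ε δ u : ℝ} (hp : p ≤ 3) (hε : 0 < ε) (hδ : 0 < δ)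
    (hδε : δ ≤ ε) (hu : 4 * ε ≤ u) :
    |((u + ε + δ) ^ p + (u - ε - δ) ^ p - (u + ε - δ) ^ p - (u - ε + δ) ^ p) / (4 * ε * δ) -
      p * (p - 1) * u ^ (p - 2)| ≤
      |p * (p - 1)| * (|p - 2| * (1 / 2) ^ (p - 3) * 2) * (ε * u ^ (p - 3)) := by
  obtain ⟨ξ, hξ, e⟩ := exists_second_difference_rpow_eq p hε hδ (by linarith : ε + δ < u)
  rw [e, ← mul_sub, abs_mul, mul_assoc]
  refine mul_le_mul_of_nonneg_left ?_ (abs_nonneg _)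
  -- This is what the threshold `4ε` is for: `ε + δ ≤ 2ε ≤ u / 2`. On `[u / 2, ∞)` the derivative of
  -- `x ^ (p - 2)` is largest in size at the left end, because `p ≤ 3`.
  have hξu : u / 2 ≤ ξ := by linarith [(abs_le.1 hξ).1]
  have := (convex_Ici (u / 2)).norm_image_sub_le_of_norm_hasDerivWithin_le
    (f := fun x : ℝ => x ^ (p - 2)) (f' := fun x : ℝ => (p - 2) * x ^ (p - 2 - 1))
    (C := |p - 2| * (u / 2) ^ (p - 3)) (x := u) (y := ξ)
    (fun x hx => (Real.hasDerivAt_rpow_const (Or.inl (by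
      have : u / 2 ≤ x := hx
      linarith : 0 < x).ne')).hasDerivWithinAt)
    (fun x hx => by
      have hx : u / 2 ≤ x := hx
      rw [norm_mul, Real.norm_eq_abs, show p - 2 - 1 = p - 3 by ring, Real.norm_of_nonneg
        (Real.rpow_nonneg (by linarith) _)]
      exact mul_le_mul_of_nonneg_left
        (Real.rpow_le_rpow_of_nonpos (by linarith) hx (by linarith)) (abs_nonneg _))
    (by simp only [mem_Ici]; linarith) hξu
  simp only [Real.norm_eq_abs] at this
  refine this.trans ?_
  have h2 : (u / 2) ^ (p - 3) = (1 / 2) ^ (p - 3) * u ^ (p - 3) := by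
    rw [← Real.mul_rpow (by norm_num) (by linarith)]; congr 1; ring
  have hu0 : 0 < u := by linarith
  calc _ ≤ |p - 2| * (u / 2) ^ (p - 3) * (2 * ε) := by gcongr; linarith
    _ = _ := by rw [h2]; ring

/-! ### Integrals of the kernel -/

theorem intervalIntegrable_abs_rpow {b : ℝ} (hb : -1 < b) (x y : ℝ) :
    IntervalIntegrable (fun v : ℝ => |v| ^ b) volume x y := by
  have h0 : ∀ z : ℝ, 0 ≤ z → IntervalIntegrable (fun v : ℝ => |v| ^ b) volume 0 z := fun z hz =>
    (intervalIntegral.intervalIntegrable_rpow' (a := 0) (b := z) hb).congr fun v hv => by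
      rw [uIoc_of_le hz] at hv
      simp only [abs_of_pos hv.1]
  have h1 : ∀ z : ℝ, IntervalIntegrable (fun v : ℝ => |v| ^ b) volume 0 z := fun z => by
    rcases le_total 0 z with hz | hz
    · exact h0 z hz
    · simpa using (h0 (-z) (by linarith)).comp_sub_left 0
  exact (h1 x).symm.trans (h1 y)

theorem integral_abs_rpow {b x : ℝ} (hb : -1 < b) (hx : 0 ≤ x) :
    ∫ v in (0 : ℝ)..x, |v| ^ b = x ^ (b + 1) / (b + 1) := by
  rw [intervalIntegral.integral_congr (g := fun v : ℝ => v ^ b), integral_rpow (Or.inl hb),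
    Real.zero_rpow (by linarith), sub_zero]
  intro v hv
  rw [uIcc_of_le hx] at hv
  simp only [abs_of_nonneg hv.1]

/-- After translation the integrals run over `[c, θ + c]` and `[-c, θ - c]`. By evenness the piece
over `[-c, 0]` equals the missing piece over `[0, c]`, so the singularity or kink at `u = c` leaves
no trace. -/
theorem integral_abs_add_rpow_add_abs_sub_rpow {b c θ : ℝ} (hb : -1 < b) (hc : 0 ≤ c)
    (hcθ : c ≤ θ) :
    ∫ u in (0 : ℝ)..θ, (|u + c| ^ b + |u - c| ^ b) =
      ((θ + c) ^ (b + 1) + (θ - c) ^ (b + 1)) / (b + 1) := by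
  have hi := fun x y : ℝ => intervalIntegrable_abs_rpow hb x y
  rw [intervalIntegral.integral_add, intervalIntegral.integral_comp_add_right (fun v => |v| ^ b),
    intervalIntegral.integral_comp_sub_right (fun v => |v| ^ b), zero_add, zero_sub,
    ← intervalIntegral.integral_add_adjacent_intervals (hi (-c) 0) (hi 0 (θ - c)),
    show ∫ v in (-c)..(0 : ℝ), |v| ^ b = ∫ v in (0 : ℝ)..c, |v| ^ b by
      rw [← neg_zero, ← intervalIntegral.integral_comp_neg]; simp,
    ← add_assoc, add_comm (∫ v in c..(θ + c), |v| ^ b),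
    intervalIntegral.integral_add_adjacent_intervals (hi 0 c) (hi c (θ + c)),
    integral_abs_rpow hb (by linarith), integral_abs_rpow hb (by linarith), add_div]
  · simpa using (hi c (θ + c)).comp_add_right c
  · simpa using (hi (-c) (θ - c)).comp_sub_right c

theorem two_mul_quotCov_eq {a ε δ u : ℝ} (hε : 0 < ε) (hδ : 0 < δ) (hu : ε + δ ≤ u) :
    2 * quotCov a ε δ u =
      ((u + ε + δ) ^ a + (u - ε - δ) ^ a - (u + ε - δ) ^ a - (u - ε + δ) ^ a) / (4 * ε * δ) := by
  unfold quotCov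
  rw [abs_of_nonneg (by linarith), abs_of_nonneg (by linarith), abs_of_nonneg (by linarith),
    abs_of_nonneg (by linarith)]
  field_simp
  ring

/-- Beyond `ε + δ` the primitive of the kernel is again a second difference quotient, now of the
power `a + 1`, so the same mean value estimate applies to it. -/
theorem integral_two_mul_quotCov_eq {a ε δ θ : ℝ} (ha : 0 < a) (hδ : 0 < δ) (hδε : δ ≤ ε)
    (hθ : ε + δ ≤ θ) :
    ∫ u in (0 : ℝ)..θ, 2 * quotCov a ε δ u =
      ((θ + ε + δ) ^ (a + 1) + (θ - ε - δ) ^ (a + 1) - (θ + ε - δ) ^ (a + 1) -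
        (θ - ε + δ) ^ (a + 1)) / (4 * ε * δ) / (a + 1) := by
  have h1 := integral_abs_add_rpow_add_abs_sub_rpow (b := a) (c := ε + δ) (θ := θ)
    (by linarith) (by linarith) hθ
  have h2 := integral_abs_add_rpow_add_abs_sub_rpow (b := a) (c := ε - δ) (θ := θ)
    (by linarith) (by linarith) (by linarith)
  have hc : ∀ c : ℝ, Continuous fun u : ℝ => |u + c| ^ a + |u - c| ^ a := fun c =>
    (Continuous.rpow_const (by fun_prop) fun _ => Or.inr ha.le).add
      (Continuous.rpow_const (by fun_prop) fun _ => Or.inr ha.le)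
  have : ∀ u, 2 * quotCov a ε δ u = ((|u + (ε + δ)| ^ a + |u - (ε + δ)| ^ a) -
      (|u + (ε - δ)| ^ a + |u - (ε - δ)| ^ a)) / (4 * ε * δ) := fun u => by
    unfold quotCov
    rw [← add_assoc, ← sub_sub, ← add_sub_assoc, ← sub_add]
    have : 0 < ε := by linarith
    field_simp
    ring_nf
  simp_rw [this]
  rw [intervalIntegral.integral_div, intervalIntegral.integral_sub
    ((hc _).intervalIntegrable _ _) ((hc _).intervalIntegrable _ _), h1, h2,
    ← add_assoc, ← sub_sub, ← add_sub_assoc, ← sub_add]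
  ring_nf

/-- The near-diagonal mass has order `ε ^ (a - 1)` whatever `δ` is. The factors `5 ^ a` and `3 ^ a`
come from the endpoints `4ε ± ε`. -/
theorem integral_abs_two_mul_quotCov_le {a ε δ : ℝ} (ha0 : 0 < a) (ha1 : a ≤ 1) (hε : 0 < ε)
    (hδ : 0 < δ) :
    ∫ u in (0 : ℝ)..(4 * ε), |2 * quotCov a ε δ u| ≤ (5 ^ a + 3 ^ a) / (2 * a) * ε ^ (a - 1) := by
  have hb : -1 < a - 1 := by linarith
  have hi1 : IntervalIntegrable (fun u : ℝ => |u + ε| ^ (a - 1)) volume 0 (4 * ε) := by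
    simpa using (intervalIntegrable_abs_rpow hb ε (4 * ε + ε)).comp_add_right ε
  have hi2 : IntervalIntegrable (fun u : ℝ => |u - ε| ^ (a - 1)) volume 0 (4 * ε) := by
    simpa using (intervalIntegrable_abs_rpow hb (-ε) (4 * ε - ε)).comp_sub_right ε
  calc ∫ u in (0 : ℝ)..(4 * ε), |2 * quotCov a ε δ u|
      ≤ ∫ u in (0 : ℝ)..(4 * ε), (|u + ε| ^ (a - 1) + |u - ε| ^ (a - 1)) / (2 * ε) := by
        refine intervalIntegral.integral_mono_ae (by positivity) ?_ ((hi1.add hi2).div_const _) ?_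
        · exact (((continuous_quotCov ha0 ε δ).const_mul 2).abs).intervalIntegrable _ _
        · have h1 : ∀ᵐ u : ℝ, u ≠ ε := by simp [ae_iff]
          have h2 : ∀ᵐ u : ℝ, u ≠ -ε := by simp [ae_iff]
          filter_upwards [h1, h2] with u hu1 hu2
          exact abs_quotCov_le ha0 ha1 hε hδ (fun h => hu2 (by linarith)) (sub_ne_zero.2 hu1)
    _ = _ := by
      rw [intervalIntegral.integral_div, integral_abs_add_rpow_add_abs_sub_rpow hb hε.le
        (by linarith), sub_add_cancel, show 4 * ε + ε = 5 * ε by ring,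
        show 4 * ε - ε = 3 * ε by ring, Real.mul_rpow (by norm_num) hε.le,
        Real.mul_rpow (by norm_num) hε.le, Real.rpow_sub_one hε.ne']
      field_simp

/-! ### Weighted `L¹` convergence of the kernel and of its primitive -/

/-- A weighted `L¹` bound for a function that decays like `ε r ^ (p - 3)` for `r ≥ 4 ε`. -/
theorem integral_abs_mul_rpow_le {h : ℝ → ℝ} {p b ε c₁ c₂ : ℝ} (hpb : p + b < 2) (hε : 0 < ε)
    (hh : ContinuousOn h (Ioi 0)) (h1 : ∀ r, 4 * ε ≤ r → |h r| ≤ c₁ * (ε * r ^ (p - 3)))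
    (hi : IntervalIntegrable (fun r => |h r| * r ^ b) volume 0 (4 * ε))
    (h2 : ∫ r in (0 : ℝ)..(4 * ε), |h r| * r ^ b ≤ c₂ * ε ^ (p + b - 1)) {t : ℝ} (ht : 0 ≤ t) :
    IntervalIntegrable (fun r => |h r| * r ^ b) volume 0 t ∧
    ∫ r in (0 : ℝ)..t, |h r| * r ^ b ≤
      (c₂ + c₁ * (4 ^ (p + b - 2) / (2 - p - b))) * ε ^ (p + b - 1) := by
  have hmaj : IntegrableOn (fun r => c₁ * ε * r ^ (p + b - 3)) (Ioi (4 * ε)) :=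
    (integrableOn_Ioi_rpow_of_lt (by linarith) (by positivity)).const_mul _
  have hle : ∀ r ∈ Ioi (4 * ε), |h r| * r ^ b ≤ c₁ * ε * r ^ (p + b - 3) := fun r hr => by
    have hr0 : 0 < r := lt_trans (by positivity) hr
    calc |h r| * r ^ b ≤ c₁ * (ε * r ^ (p - 3)) * r ^ b := by
          gcongr
          exact h1 r (le_of_lt hr)
      _ = _ := by rw [show p + b - 3 = p - 3 + b by ring, Real.rpow_add hr0]; ring
  have hcont : ContinuousOn (fun r => |h r| * r ^ b) (Ioi 0) :=
    hh.abs.mul fun r hr => (Real.continuousAt_rpow_const r b (Or.inl (ne_of_gt hr)))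
      |>.continuousWithinAt
  have hi1 : IntegrableOn (fun r => |h r| * r ^ b) (Ioc 0 (4 * ε)) :=
    (intervalIntegrable_iff_integrableOn_Ioc_of_le (by positivity)).1 hi
  have hi2 : IntegrableOn (fun r => |h r| * r ^ b) (Ioi (4 * ε)) := by
    refine hmaj.mono' ((hcont.mono (Ioi_subset_Ioi (by positivity))).aestronglyMeasurable
      measurableSet_Ioi) ?_
    refine (ae_restrict_mem measurableSet_Ioi).mono fun r hr => ?_
    have hr0 : 0 < r := lt_trans (by positivity) hr
    rw [Real.norm_of_nonneg (by positivity)]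
    exact hle r hr
  have hu : Ioi (0 : ℝ) = Ioc 0 (4 * ε) ∪ Ioi (4 * ε) := (Ioc_union_Ioi_eq_Ioi (by positivity)).symm
  have hi3 : IntegrableOn (fun r => |h r| * r ^ b) (Ioi 0) := hu ▸ hi1.union hi2
  refine ⟨(intervalIntegrable_iff_integrableOn_Ioc_of_le ht).2 (hi3.mono_set Ioc_subset_Ioi_self),
    ?_⟩
  rw [intervalIntegral.integral_of_le ht]
  rw [intervalIntegral.integral_of_le (by positivity)] at h2
  -- Enlarging the domain to the half-line makes the bound independent of `t`; the tail converges
  -- because `p + b < 2`.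
  calc _ ≤ ∫ r in Ioi 0, |h r| * r ^ b := by
        refine setIntegral_mono_set hi3 ?_ Ioc_subset_Ioi_self.eventuallyLE
        refine (ae_restrict_mem measurableSet_Ioi).mono fun r hr => ?_
        have hr0 : 0 < r := hr
        simp only [Pi.zero_apply]
        positivity
    _ = (∫ r in Ioc 0 (4 * ε), |h r| * r ^ b) + ∫ r in Ioi (4 * ε), |h r| * r ^ b := by
        rw [hu, setIntegral_union (Ioc_disjoint_Ioi le_rfl) measurableSet_Ioi hi1 hi2]
    _ ≤ c₂ * ε ^ (p + b - 1) + ∫ r in Ioi (4 * ε), c₁ * ε * r ^ (p + b - 3) :=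
        add_le_add h2 (setIntegral_mono_on hi2 hmaj measurableSet_Ioi hle)
    _ = _ := by
        rw [integral_const_mul, integral_Ioi_rpow_of_lt (by linarith) (by positivity),
          show p + b - 3 + 1 = p + b - 2 by ring, Real.mul_rpow (by norm_num) hε.le,
          show p + b - 1 = p + b - 2 + 1 by ring, Real.rpow_add_one hε.ne']
        rw [show p + b - 2 = -(2 - p - b) by ring, neg_div_neg_eq]
        ring

theorem exists_integral_abs_quotCov_sub_mul_rpow_le {a β : ℝ} (ha0 : 0 < a) (ha1 : a < 1)
    (hβ1 : β ≤ 1) (hβ : 1 < a + β) :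
    ∃ c, 0 ≤ c ∧ ∀ ε δ : ℝ, 0 < δ → δ ≤ ε → ∀ t, 0 ≤ t →
      IntervalIntegrable
        (fun r => |2 * quotCov a ε δ r - a * (a - 1) * r ^ (a - 2)| * r ^ β) volume 0 t ∧
      ∫ r in (0 : ℝ)..t, |2 * quotCov a ε δ r - a * (a - 1) * r ^ (a - 2)| * r ^ β ≤
        c * ε ^ (a + β - 1) := by
  have hβ0 : 0 < β := by linarith
  -- The first two terms bound the kernel and its limit separately on `(0, 4ε]`; the last is the
  -- tail from the mean value estimate.
  refine ⟨(4 ^ β * ((5 ^ a + 3 ^ a) / (2 * a)) +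
    |a * (a - 1)| * (4 ^ (a + β - 1) / (a + β - 1))) +
    |a * (a - 1)| * (|a - 2| * (1 / 2) ^ (a - 3) * 2) * (4 ^ (a + β - 2) / (2 - a - β)), ?_, ?_⟩
  · have := sub_pos.2 hβ
    have h2 : 0 < 2 - a - β := by linarith
    positivity
  intro ε δ hδ hδε t ht
  have hε : 0 < ε := hδ.trans_le hδε
  have hcont : ContinuousOn (fun r => 2 * quotCov a ε δ r - a * (a - 1) * r ^ (a - 2)) (Ioi 0) :=
    ((continuous_quotCov ha0 ε δ).const_mul 2).continuousOn.sub
      (continuousOn_const.mul fun r hr =>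
        (Real.continuousAt_rpow_const r _ (Or.inl (ne_of_gt hr))).continuousWithinAt)
  have hmaj : IntervalIntegrable (fun r => (4 * ε) ^ β * |2 * quotCov a ε δ r| +
      |a * (a - 1)| * r ^ (a + β - 2)) volume 0 (4 * ε) :=
    ((((continuous_quotCov ha0 ε δ).const_mul 2).abs).intervalIntegrable _ _ |>.const_mul _).add
      ((intervalIntegral.intervalIntegrable_rpow' (by linarith)).const_mul _)
  have hle : ∀ r ∈ Ioc (0 : ℝ) (4 * ε),
      |2 * quotCov a ε δ r - a * (a - 1) * r ^ (a - 2)| * r ^ β ≤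
      (4 * ε) ^ β * |2 * quotCov a ε δ r| + |a * (a - 1)| * r ^ (a + β - 2) := fun r hr => by
    have hr0 : 0 < r := hr.1
    have hrβ : r ^ β ≤ (4 * ε) ^ β := Real.rpow_le_rpow hr0.le hr.2 hβ0.le
    calc _ ≤ (|2 * quotCov a ε δ r| + |a * (a - 1) * r ^ (a - 2)|) * r ^ β := by
          gcongr
          exact abs_sub _ _
      _ = r ^ β * |2 * quotCov a ε δ r| + |a * (a - 1)| * (r ^ (a - 2) * r ^ β) := by
          rw [abs_mul (a * (a - 1)), abs_of_nonneg (Real.rpow_nonneg hr0.le (a - 2))]; ring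
      _ ≤ _ := by
          rw [← Real.rpow_add hr0, show a - 2 + β = a + β - 2 by ring]
          gcongr
  have hi : IntervalIntegrable
      (fun r => |2 * quotCov a ε δ r - a * (a - 1) * r ^ (a - 2)| * r ^ β)
      volume 0 (4 * ε) := by
    rw [intervalIntegrable_iff_integrableOn_Ioc_of_le (by positivity)] at hmaj ⊢
    refine hmaj.mono' (((hcont.abs.mul fun r hr => (Real.continuousAt_rpow_const r β
      (Or.inl (ne_of_gt hr))).continuousWithinAt).mono Ioc_subset_Ioi_self).aestronglyMeasurable
        measurableSet_Ioc) ?_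
    refine (ae_restrict_mem measurableSet_Ioc).mono fun r hr => ?_
    have hr0 : 0 < r := hr.1
    rw [Real.norm_of_nonneg (by positivity)]
    exact hle r hr
  refine integral_abs_mul_rpow_le (by linarith) hε hcont ?_ hi ?_ ht
  · intro r hr
    rw [two_mul_quotCov_eq hε hδ (by linarith)]
    exact abs_second_difference_rpow_sub_le (by linarith) hε hδ hδε hr
  · have h1 := integral_abs_two_mul_quotCov_le ha0 ha1.le hε hδ
    have h4 : (0 : ℝ) ≤ 4 * ε := by positivity
    calc _ ≤ ∫ r in (0 : ℝ)..(4 * ε), ((4 * ε) ^ β * |2 * quotCov a ε δ r| +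
          |a * (a - 1)| * r ^ (a + β - 2)) :=
          intervalIntegral.integral_mono_on_of_le_Ioo h4 hi hmaj fun r hr => hle r ⟨hr.1, hr.2.le⟩
      _ = (4 * ε) ^ β * (∫ r in (0 : ℝ)..(4 * ε), |2 * quotCov a ε δ r|) +
          |a * (a - 1)| * ((4 * ε) ^ (a + β - 1) / (a + β - 1)) := by
          rw [intervalIntegral.integral_add
            ((((continuous_quotCov ha0 ε δ).const_mul 2).abs).intervalIntegrable _ _
              |>.const_mul _)
            ((intervalIntegral.intervalIntegrable_rpow' (by linarith)).const_mul _),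
            intervalIntegral.integral_const_mul, intervalIntegral.integral_const_mul,
            integral_rpow (Or.inl (by linarith)), show a + β - 2 + 1 = a + β - 1 by ring,
            Real.zero_rpow (by linarith), sub_zero]
      _ ≤ (4 * ε) ^ β * ((5 ^ a + 3 ^ a) / (2 * a) * ε ^ (a - 1)) +
          |a * (a - 1)| * ((4 * ε) ^ (a + β - 1) / (a + β - 1)) := by gcongr
      _ = _ := by
          rw [Real.mul_rpow (by norm_num) hε.le, Real.mul_rpow (by norm_num) hε.le,
            show a + β - 1 = a - 1 + β by ring, Real.rpow_add hε]
          ring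

/-- The general bound is used with `p = a + 1` and weight exponent `b = β - 1`. This weight is
chosen so that the error has the exponent `a + β - 1` of the previous estimate for every `ε > 0`,
large steps included. -/
theorem exists_integral_abs_integral_quotCov_sub_le {a β : ℝ} (ha0 : 0 < a) (ha1 : a < 1)
    (hβ1 : β ≤ 1) (hβ : 1 < a + β) :
    ∃ c, 0 ≤ c ∧ ∀ ε δ : ℝ, 0 < δ → δ ≤ ε → ∀ t, 0 ≤ t →
      IntervalIntegrable (fun θ =>
        |(∫ r in (0 : ℝ)..θ, 2 * quotCov a ε δ r) - a * θ ^ (a - 1)| * θ ^ (β - 1)) volume 0 t ∧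
      ∫ θ in (0 : ℝ)..t,
        |(∫ r in (0 : ℝ)..θ, 2 * quotCov a ε δ r) - a * θ ^ (a - 1)| * θ ^ (β - 1) ≤
        c * ε ^ (a + β - 1) := by
  have hβ0 : 0 < β := by linarith
  refine ⟨((5 ^ a + 3 ^ a) / (2 * a) * (4 ^ β / β) + a * (4 ^ (a + β - 1) / (a + β - 1))) +
    |(a + 1) * (a + 1 - 1)| * (|a + 1 - 2| * (1 / 2) ^ (a + 1 - 3) * 2) / (a + 1) *
      (4 ^ (a + 1 + (β - 1) - 2) / (2 - (a + 1) - (β - 1))), ?_, ?_⟩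
  · have := sub_pos.2 hβ
    have h2 : 0 < 2 - (a + 1) - (β - 1) := by linarith
    positivity
  intro ε δ hδ hδε t ht
  have hε : 0 < ε := hδ.trans_le hδε
  have hK : Continuous fun r => 2 * quotCov a ε δ r := (continuous_quotCov ha0 ε δ).const_mul 2
  have hcont : ContinuousOn
      (fun θ => (∫ r in (0 : ℝ)..θ, 2 * quotCov a ε δ r) - a * θ ^ (a - 1)) (Ioi 0) :=
    (intervalIntegral.continuous_primitive (fun _ _ => hK.intervalIntegrable _ _) 0).continuousOn.sub
      (continuousOn_const.mul fun r hr =>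
        (Real.continuousAt_rpow_const r _ (Or.inl (ne_of_gt hr))).continuousWithinAt)
  have hm1 : IntervalIntegrable
      (fun θ : ℝ => (5 ^ a + 3 ^ a) / (2 * a) * ε ^ (a - 1) * θ ^ (β - 1)) volume 0 (4 * ε) :=
    (intervalIntegral.intervalIntegrable_rpow' (by linarith)).const_mul _
  have hm2 : IntervalIntegrable (fun θ : ℝ => a * θ ^ (a + β - 2)) volume 0 (4 * ε) :=
    (intervalIntegral.intervalIntegrable_rpow' (by linarith)).const_mul _
  have hmaj := hm1.add hm2
  have hle : ∀ θ ∈ Ioc (0 : ℝ) (4 * ε),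
      |(∫ r in (0 : ℝ)..θ, 2 * quotCov a ε δ r) - a * θ ^ (a - 1)| * θ ^ (β - 1) ≤
      (5 ^ a + 3 ^ a) / (2 * a) * ε ^ (a - 1) * θ ^ (β - 1) + a * θ ^ (a + β - 2) :=
    fun θ hθ => by
    have hθ0 : 0 < θ := hθ.1
    have h1 : |∫ r in (0 : ℝ)..θ, 2 * quotCov a ε δ r| ≤
        (5 ^ a + 3 ^ a) / (2 * a) * ε ^ (a - 1) :=
      (intervalIntegral.abs_integral_le_integral_abs hθ0.le).trans
        ((intervalIntegral.integral_mono_interval le_rfl hθ0.le hθ.2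
          (ae_of_all _ fun _ => abs_nonneg _) (hK.abs.intervalIntegrable _ _)).trans
          (integral_abs_two_mul_quotCov_le ha0 ha1.le hε hδ))
    calc _ ≤ (|∫ r in (0 : ℝ)..θ, 2 * quotCov a ε δ r| + |a * θ ^ (a - 1)|) * θ ^ (β - 1) := by
          gcongr
          exact abs_sub _ _
      _ ≤ ((5 ^ a + 3 ^ a) / (2 * a) * ε ^ (a - 1) + a * θ ^ (a - 1)) * θ ^ (β - 1) := by
          rw [abs_of_nonneg (by positivity : 0 ≤ a * θ ^ (a - 1))]
          gcongr
      _ = _ := by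
          rw [show a + β - 2 = a - 1 + (β - 1) by ring, Real.rpow_add hθ0]; ring
  have hi : IntervalIntegrable (fun θ =>
      |(∫ r in (0 : ℝ)..θ, 2 * quotCov a ε δ r) - a * θ ^ (a - 1)| * θ ^ (β - 1))
      volume 0 (4 * ε) := by
    rw [intervalIntegrable_iff_integrableOn_Ioc_of_le (by positivity)] at hmaj ⊢
    refine hmaj.mono' (((hcont.abs.mul fun r hr => (Real.continuousAt_rpow_const r (β - 1)
      (Or.inl (ne_of_gt hr))).continuousWithinAt).mono Ioc_subset_Ioi_self).aestronglyMeasurable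
        measurableSet_Ioc) ?_
    refine (ae_restrict_mem measurableSet_Ioc).mono fun r hr => ?_
    have hr0 : 0 < r := hr.1
    rw [Real.norm_of_nonneg (by positivity)]
    exact hle r hr
  rw [show a + β - 1 = a + 1 + (β - 1) - 1 by ring]
  refine integral_abs_mul_rpow_le (by linarith) hε hcont ?_ hi ?_ ht
  · intro θ hθ
    rw [integral_two_mul_quotCov_eq ha0 hδ hδε (by linarith)]
    have h := abs_second_difference_rpow_sub_le (p := a + 1) (by linarith) hε hδ hδε hθ
    rw [show a + 1 - 2 = a - 1 by ring] at h ⊢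
    set D := ((θ + ε + δ) ^ (a + 1) + (θ - ε - δ) ^ (a + 1) - (θ + ε - δ) ^ (a + 1) -
        (θ - ε + δ) ^ (a + 1)) / (4 * ε * δ)
    -- Since `a = (a + 1) * a / (a + 1)`, the error is that of the second difference for the power
    -- `a + 1`, divided by `a + 1`.
    have e : D / (a + 1) - a * θ ^ (a - 1) =
        (D - (a + 1) * (a + 1 - 1) * θ ^ (a - 1)) / (a + 1) := by field_simp; ring
    rw [e, abs_div, abs_of_pos (by linarith : 0 < a + 1), div_mul_eq_mul_div]
    gcongr
  · have h4 : (0 : ℝ) ≤ 4 * ε := by positivity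
    calc _ ≤ ∫ θ in (0 : ℝ)..(4 * ε), ((5 ^ a + 3 ^ a) / (2 * a) * ε ^ (a - 1) * θ ^ (β - 1) +
          a * θ ^ (a + β - 2)) :=
          intervalIntegral.integral_mono_on_of_le_Ioo h4 hi hmaj fun r hr => hle r ⟨hr.1, hr.2.le⟩
      _ = (5 ^ a + 3 ^ a) / (2 * a) * ε ^ (a - 1) * ((4 * ε) ^ β / β) +
          a * ((4 * ε) ^ (a + β - 1) / (a + β - 1)) := by
          rw [intervalIntegral.integral_add hm1 hm2,
            intervalIntegral.integral_const_mul, intervalIntegral.integral_const_mul,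
            integral_rpow (Or.inl (by linarith)), integral_rpow (Or.inl (by linarith)),
            show a + β - 2 + 1 = a + β - 1 by ring, sub_add_cancel,
            Real.zero_rpow (by linarith), Real.zero_rpow (by linarith), sub_zero, sub_zero]
      _ = _ := by
          rw [Real.mul_rpow (by norm_num) hε.le, Real.mul_rpow (by norm_num) hε.le,
            show a + 1 + (β - 1) - 1 = a - 1 + β by ring, show a + β - 1 = a - 1 + β by ring,
            Real.rpow_add hε]
          ring

/-! ### The variance functional and its approximation -/

/-- The variance of the nonlinear integral on `[0, t]`, for the fractional exponent `a = 2 H` and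
the spatial covariance `q s r` along the path. -/
noncomputable def nonlinearVariance (a : ℝ) (q : ℝ → ℝ → ℝ) (t : ℝ) : ℝ :=
  a * (∫ θ in (0 : ℝ)..t, θ ^ (a - 1) * q θ θ) +
    a * (a - 1) * ∫ θ in (0 : ℝ)..t, ∫ r in (0 : ℝ)..θ, r ^ (a - 2) * (q θ (θ - r) - q θ θ)

theorem integral_integral_eq_two_mul_of_symm {F : ℝ → ℝ → ℝ} (hF : Continuous (Function.uncurry F))
    (hs : ∀ s r, F s r = F r s) {t : ℝ} (ht : 0 ≤ t) :
    ∫ s in (0 : ℝ)..t, ∫ r in (0 : ℝ)..t, F s r =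
      2 * ∫ s in (0 : ℝ)..t, ∫ r in (0 : ℝ)..s, F s r := by
  have hFs : ∀ s, Continuous (F s) := fun s => hF.comp (by fun_prop : Continuous fun r => (s, r))
  have hc1 : Continuous fun s => ∫ r in (0 : ℝ)..s, F s r :=
    intervalIntegral.continuous_parametric_intervalIntegral_of_continuous hF continuous_id
  have hc2 : Continuous fun s => ∫ r in s..t, F s r := by
    have : (fun s => ∫ r in s..t, F s r) =
        fun s => (∫ r in (0 : ℝ)..t, F s r) - ∫ r in (0 : ℝ)..s, F s r := by
      funext s
      rw [intervalIntegral.integral_interval_sub_left] <;> exact (hFs s).intervalIntegrable _ _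
    rw [this]
    exact (intervalIntegral.continuous_parametric_intervalIntegral_of_continuous hF
      continuous_const).sub hc1
  have hswap : ∫ s in (0 : ℝ)..t, ∫ r in s..t, F s r =
      ∫ s in (0 : ℝ)..t, ∫ r in (0 : ℝ)..s, F s r := by
    have hint : IntegrableOn (Function.uncurry F) (Ioc 0 t ×ˢ Ioc 0 t) (volume.prod volume) :=
      (hF.continuousOn.integrableOn_compact (isCompact_Icc.prod isCompact_Icc)).mono_set
        (prod_mono Ioc_subset_Icc_self Ioc_subset_Icc_self)
    rw [IntegrableOn, ← Measure.prod_restrict] at hint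
    have hint2 : Integrable (Function.uncurry fun s r => (Ioi s).indicator (F s) r)
        ((volume.restrict (Ioc 0 t)).prod (volume.restrict (Ioc 0 t))) := by
      have : (Function.uncurry fun s r => (Ioi s).indicator (F s) r) =
          {p : ℝ × ℝ | p.1 < p.2}.indicator (Function.uncurry F) := by
        funext ⟨s, r⟩
        simp [indicator]
      rw [this]
      exact hint.indicator (measurableSet_lt measurable_fst measurable_snd)
    rw [intervalIntegral.integral_of_le ht, intervalIntegral.integral_of_le ht]
    calc ∫ s in Ioc 0 t, ∫ r in s..t, F s r
        = ∫ s in Ioc 0 t, ∫ r in Ioc 0 t, (Ioi s).indicator (F s) r := by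
          refine setIntegral_congr_fun measurableSet_Ioc fun s hs => ?_
          rw [intervalIntegral.integral_of_le hs.2, setIntegral_indicator measurableSet_Ioi,
            Ioc_inter_Ioi, sup_eq_right.2 hs.1.le]
      _ = ∫ r in Ioc 0 t, ∫ s in Ioc 0 t, (Ioi s).indicator (F s) r :=
          integral_integral_swap hint2
      _ = ∫ r in Ioc 0 t, ∫ s in (0 : ℝ)..r, F r s := by
          refine setIntegral_congr_fun measurableSet_Ioc fun r hr => ?_
          -- Symmetry of `F` relabels the upper triangle as the lower one. It appears as `s < r`,
          -- and the endpoint is a null set.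
          have : (fun s => (Ioi s).indicator (F s) r) = (Iio r).indicator (F r) := by
            funext s
            simp [indicator, hs s r]
          rw [this, intervalIntegral.integral_of_le hr.1.le, setIntegral_indicator measurableSet_Iio,
            integral_Ioc_eq_integral_Ioo]
          congr 2
          ext s
          simp only [mem_inter_iff, mem_Ioc, mem_Iio, mem_Ioo]
          exact ⟨fun h => ⟨h.1.1, h.2⟩, fun h => ⟨⟨h.1, h.2.le.trans hr.2⟩, h.2⟩⟩
  rw [two_mul]
  nth_rw 2 [← hswap]
  rw [← intervalIntegral.integral_add (hc1.intervalIntegrable _ _) (hc2.intervalIntegrable _ _)]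
  refine intervalIntegral.integral_congr fun s _ => ?_
  exact (intervalIntegral.integral_add_adjacent_intervals ((hFs s).intervalIntegrable _ _)
    ((hFs s).intervalIntegrable _ _)).symm

section Kernel

variable {a β T B₀ B₁ : ℝ} {q : ℝ → ℝ → ℝ}

theorem intervalIntegrable_rpow_mul_diag (ha0 : 0 < a) (hq : Continuous (Function.uncurry q))
    (t : ℝ) : IntervalIntegrable (fun θ : ℝ => θ ^ (a - 1) * q θ θ) volume 0 t :=
  (intervalIntegral.intervalIntegrable_rpow' (by linarith)).mul_continuousOn
    (hq.comp (by fun_prop : Continuous fun s : ℝ => (s, s))).continuousOn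

theorem norm_rpow_mul_sub_le (hq1 : ∀ s ∈ Icc 0 T, ∀ r ∈ Icc 0 T, |q s r - q s s| ≤ B₁ * |s - r| ^ β)
    {θ r : ℝ} (hθ : θ ∈ Icc 0 T) (hr : r ∈ Ioc 0 θ) :
    ‖r ^ (a - 2) * (q θ (θ - r) - q θ θ)‖ ≤ B₁ * r ^ (a + β - 2) := by
  have hr0 : 0 < r := hr.1
  have := hq1 θ hθ (θ - r) ⟨by linarith [hr.2], by linarith [hθ.2]⟩
  rw [sub_sub_cancel, abs_of_pos hr0] at this
  rw [norm_mul, Real.norm_of_nonneg (by positivity), Real.norm_eq_abs,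
    show a + β - 2 = a - 2 + β by ring, Real.rpow_add hr0]
  calc _ ≤ r ^ (a - 2) * (B₁ * r ^ β) := by gcongr
    _ = _ := by ring

theorem intervalIntegrable_rpow_mul_sub (hβ : 1 < a + β) (hq : Continuous (Function.uncurry q))
    (hq1 : ∀ s ∈ Icc 0 T, ∀ r ∈ Icc 0 T, |q s r - q s s| ≤ B₁ * |s - r| ^ β)
    {θ : ℝ} (hθ : θ ∈ Icc 0 T) :
    IntervalIntegrable (fun r : ℝ => r ^ (a - 2) * (q θ (θ - r) - q θ θ)) volume 0 θ := by
  have hmaj : IntervalIntegrable (fun r : ℝ => B₁ * r ^ (a + β - 2)) volume 0 θ :=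
    (intervalIntegral.intervalIntegrable_rpow' (by linarith)).const_mul _
  rw [intervalIntegrable_iff_integrableOn_Ioc_of_le hθ.1] at hmaj ⊢
  have hm : Continuous fun r => q θ (θ - r) - q θ θ :=
    (hq.comp (by fun_prop : Continuous fun r : ℝ => (θ, θ - r))).sub continuous_const
  refine hmaj.mono' ?_ ((ae_restrict_mem measurableSet_Ioc).mono fun r hr =>
    norm_rpow_mul_sub_le hq1 hθ hr)
  exact ((by fun_prop : Measurable fun r : ℝ => r ^ (a - 2)).mul hm.measurable).aestronglyMeasurable

theorem intervalIntegrable_integral_rpow_mul_sub (hβ : 1 < a + β)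
    (hq : Continuous (Function.uncurry q))
    (hq1 : ∀ s ∈ Icc 0 T, ∀ r ∈ Icc 0 T, |q s r - q s s| ≤ B₁ * |s - r| ^ β) (hB₁ : 0 ≤ B₁)
    {t : ℝ} (ht : t ∈ Icc 0 T) :
    IntervalIntegrable (fun θ : ℝ => ∫ r in (0 : ℝ)..θ,
      r ^ (a - 2) * (q θ (θ - r) - q θ θ)) volume 0 t := by
  rw [intervalIntegrable_iff_integrableOn_Ioc_of_le ht.1]
  -- The inner domain depends on `θ`. An indicator turns it into the fixed interval `(0, t]`, so
  -- that measurability in `θ` is that of a parametric integral.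
  have hcongr : EqOn (fun θ : ℝ => ∫ r in Ioc 0 t, {p : ℝ × ℝ | p.2 ≤ p.1}.indicator
      (fun p => p.2 ^ (a - 2) * (q p.1 (p.1 - p.2) - q p.1 p.1)) (θ, r))
      (fun θ : ℝ => ∫ r in (0 : ℝ)..θ, r ^ (a - 2) * (q θ (θ - r) - q θ θ)) (Ioc 0 t) := by
    intro θ hθ
    simp only
    rw [intervalIntegral.integral_of_le hθ.1.le]
    have : (fun r => {p : ℝ × ℝ | p.2 ≤ p.1}.indicator
        (fun p => p.2 ^ (a - 2) * (q p.1 (p.1 - p.2) - q p.1 p.1)) (θ, r)) =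
        (Iic θ).indicator fun r => r ^ (a - 2) * (q θ (θ - r) - q θ θ) := by
      funext r
      simp [indicator]
    rw [this, setIntegral_indicator measurableSet_Iic, Ioc_inter_Iic, inf_eq_right.2 hθ.2]
  refine IntegrableOn.congr_fun ?_ hcongr measurableSet_Ioc
  have hmeas : StronglyMeasurable ({p : ℝ × ℝ | p.2 ≤ p.1}.indicator
      (fun p => p.2 ^ (a - 2) * (q p.1 (p.1 - p.2) - q p.1 p.1))) := by
    have h1 : Continuous fun p : ℝ × ℝ => q p.1 (p.1 - p.2) - q p.1 p.1 :=
      (hq.comp (by fun_prop : Continuous fun p : ℝ × ℝ => (p.1, p.1 - p.2))).sub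
        (hq.comp (by fun_prop : Continuous fun p : ℝ × ℝ => (p.1, p.1)))
    exact (((by fun_prop : Measurable fun p : ℝ × ℝ => p.2 ^ (a - 2)).mul
      h1.measurable).indicator (measurableSet_le measurable_snd measurable_fst)).stronglyMeasurable
  refine Measure.integrableOn_of_bounded (M := B₁ * (T ^ (a + β - 1) / (a + β - 1))) (by simp)
    hmeas.integral_prod_right'.aestronglyMeasurable ?_
  refine (ae_restrict_mem measurableSet_Ioc).mono fun θ hθ => ?_
  have hθT : θ ∈ Icc 0 T := ⟨hθ.1.le, hθ.2.trans ht.2⟩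
  rw [show (∫ r in Ioc 0 t, {p : ℝ × ℝ | p.2 ≤ p.1}.indicator
      (fun p => p.2 ^ (a - 2) * (q p.1 (p.1 - p.2) - q p.1 p.1)) (θ, r)) = _ from hcongr hθ]
  refine (intervalIntegral.norm_integral_le_of_norm_le hθT.1 (ae_of_all _ fun r hr =>
    norm_rpow_mul_sub_le hq1 hθT hr) ((intervalIntegral.intervalIntegrable_rpow'
      (by linarith)).const_mul _)).trans ?_
  rw [intervalIntegral.integral_const_mul, integral_rpow (Or.inl (by linarith)),
    show a + β - 2 + 1 = a + β - 1 by ring, Real.zero_rpow (by linarith), sub_zero]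
  have := sub_pos.2 hβ
  have := Real.rpow_le_rpow hθT.1 hθT.2 this.le
  gcongr

/-- Substitute `r ↦ θ - r` in the folded integral and add and subtract `q θ θ`. The limiting kernel
is then paired only with increments of `q`, while on the diagonal only the primitive of the kernel
occurs. -/
theorem integral_quotCov_sub_nonlinearVariance_eq (ha0 : 0 < a) (hβ : 1 < a + β)
    (hq : Continuous (Function.uncurry q)) (hsymm : ∀ s r, q s r = q r s) (hB₁ : 0 ≤ B₁)
    (hq1 : ∀ s ∈ Icc 0 T, ∀ r ∈ Icc 0 T, |q s r - q s s| ≤ B₁ * |s - r| ^ β) (ε δ : ℝ)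
    {t : ℝ} (ht : t ∈ Icc 0 T) :
    (∫ s in (0 : ℝ)..t, ∫ r in (0 : ℝ)..t, quotCov a ε δ (s - r) * q s r) -
        nonlinearVariance a q t =
      (∫ θ in (0 : ℝ)..t, ∫ r in (0 : ℝ)..θ,
        (2 * quotCov a ε δ r - a * (a - 1) * r ^ (a - 2)) * (q θ (θ - r) - q θ θ)) +
      ∫ θ in (0 : ℝ)..t,
        ((∫ r in (0 : ℝ)..θ, 2 * quotCov a ε δ r) - a * θ ^ (a - 1)) * q θ θ := by
  have hK := continuous_quotCov ha0 ε δ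
  have hK2 : Continuous fun r => 2 * quotCov a ε δ r := hK.const_mul 2
  have hqd : Continuous fun s => q s s := hq.comp (by fun_prop : Continuous fun s : ℝ => (s, s))
  have hcm : Continuous (Function.uncurry fun θ r => 2 * quotCov a ε δ r * (q θ (θ - r) - q θ θ)) :=
    (hK2.comp continuous_snd).mul
      ((hq.comp (by fun_prop : Continuous fun p : ℝ × ℝ => (p.1, p.1 - p.2))).sub
        (hqd.comp continuous_fst))
  have hcθ : ∀ θ, Continuous fun r => 2 * quotCov a ε δ r * (q θ (θ - r) - q θ θ) := fun θ =>
    Continuous.uncurry_left θ hcm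
  have hci : Continuous fun θ => ∫ r in (0 : ℝ)..θ, 2 * quotCov a ε δ r * (q θ (θ - r) - q θ θ) :=
    intervalIntegral.continuous_parametric_intervalIntegral_of_continuous hcm continuous_id
  have hcd : Continuous fun θ => q θ θ * ∫ r in (0 : ℝ)..θ, 2 * quotCov a ε δ r :=
    hqd.mul (intervalIntegral.continuous_primitive (fun _ _ => hK2.intervalIntegrable _ _) 0)
  have hcF : Continuous (Function.uncurry fun s r => quotCov a ε δ (s - r) * q s r) :=
    (hK.comp (by fun_prop : Continuous fun p : ℝ × ℝ => p.1 - p.2)).mul hq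
  have hfold : ∫ s in (0 : ℝ)..t, ∫ r in (0 : ℝ)..t, quotCov a ε δ (s - r) * q s r =
      (∫ θ in (0 : ℝ)..t, ∫ r in (0 : ℝ)..θ, 2 * quotCov a ε δ r * (q θ (θ - r) - q θ θ)) +
      ∫ θ in (0 : ℝ)..t, q θ θ * ∫ r in (0 : ℝ)..θ, 2 * quotCov a ε δ r := by
    rw [integral_integral_eq_two_mul_of_symm hcF
      (fun s r => by rw [hsymm, ← quotCov_neg, neg_sub]) ht.1, ← intervalIntegral.integral_add
      (hci.intervalIntegrable _ _) (hcd.intervalIntegrable _ _),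
      ← intervalIntegral.integral_const_mul]
    refine intervalIntegral.integral_congr fun θ _ => ?_
    have e := intervalIntegral.integral_comp_sub_left (a := 0) (b := θ)
      (fun r => quotCov a ε δ (θ - r) * q θ r) θ
    rw [sub_self, sub_zero] at e
    rw [← e, ← intervalIntegral.integral_const_mul, ← intervalIntegral.integral_const_mul,
      ← intervalIntegral.integral_add ((hcθ θ).intervalIntegrable _ _)
        ((hK2.const_mul _).intervalIntegrable _ _)]
    refine intervalIntegral.integral_congr fun r _ => ?_
    simp only [sub_sub_cancel]
    ring
  have hdiag := intervalIntegrable_rpow_mul_diag ha0 hq t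
  have hdbl := intervalIntegrable_integral_rpow_mul_sub hβ hq hq1 hB₁ ht
  rw [hfold, nonlinearVariance, add_comm (a * _), add_sub_add_comm]
  congr 1
  · rw [← intervalIntegral.integral_const_mul, ← intervalIntegral.integral_sub
      (hci.intervalIntegrable _ _) (hdbl.const_mul _)]
    refine intervalIntegral.integral_congr fun θ hθ => ?_
    rw [uIcc_of_le ht.1] at hθ
    have hi := intervalIntegrable_rpow_mul_sub hβ hq hq1 (θ := θ) ⟨hθ.1, hθ.2.trans ht.2⟩
    rw [← intervalIntegral.integral_const_mul, ← intervalIntegral.integral_sub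
        ((hcθ θ).intervalIntegrable _ _) (hi.const_mul _)]
    refine intervalIntegral.integral_congr fun r _ => ?_
    ring
  · rw [← intervalIntegral.integral_const_mul, ← intervalIntegral.integral_sub
      (hcd.intervalIntegrable _ _) (hdiag.const_mul _)]
    refine intervalIntegral.integral_congr fun θ _ => ?_
    ring

/-- The constant is chosen before `q`, `B₀` and `B₁`: the spatial covariance enters only through its
diagonal bound and its Hölder bound, each paired with one of the two kernel estimates. -/
theorem exists_abs_integral_quotCov_sub_le (ha0 : 0 < a) (ha1 : a < 1)
    (hβ1 : β ≤ 1) (hβ : 1 < a + β) (hT : 0 < T) :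
    ∃ c, 0 ≤ c ∧ ∀ (q : ℝ → ℝ → ℝ) (B₀ B₁ : ℝ), Continuous (Function.uncurry q) →
      (∀ s r, q s r = q r s) → 0 ≤ B₀ → 0 ≤ B₁ → (∀ s ∈ Icc 0 T, |q s s| ≤ B₀) →
      (∀ s ∈ Icc 0 T, ∀ r ∈ Icc 0 T, |q s r - q s s| ≤ B₁ * |s - r| ^ β) →
      ∀ ε δ : ℝ, 0 < δ → δ ≤ ε → ∀ t ∈ Icc 0 T,
      |(∫ s in (0 : ℝ)..t, ∫ r in (0 : ℝ)..t, quotCov a ε δ (s - r) * q s r) -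
        nonlinearVariance a q t| ≤ c * (B₀ + B₁) * ε ^ (a + β - 1) := by
  obtain ⟨c₁, hc₁, h1⟩ := exists_integral_abs_quotCov_sub_mul_rpow_le ha0 ha1 hβ1 hβ
  obtain ⟨c₂, hc₂, h2⟩ := exists_integral_abs_integral_quotCov_sub_le ha0 ha1 hβ1 hβ
  refine ⟨T * c₁ + T ^ (1 - β) * c₂, by positivity, ?_⟩
  intro q B₀ B₁ hq hsymm hB₀ hB₁ hq0 hq1 ε δ hδ hδε t ht
  have hε : 0 < ε := hδ.trans_le hδε
  rw [integral_quotCov_sub_nonlinearVariance_eq ha0 hβ hq hsymm hB₁ hq1 ε δ ht]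
  have b1 : |∫ θ in (0 : ℝ)..t, ∫ r in (0 : ℝ)..θ,
      (2 * quotCov a ε δ r - a * (a - 1) * r ^ (a - 2)) * (q θ (θ - r) - q θ θ)| ≤
      T * c₁ * B₁ * ε ^ (a + β - 1) := by
    have := intervalIntegral.norm_integral_le_of_norm_le_const (a := 0) (b := t)
      (f := fun θ => ∫ r in (0 : ℝ)..θ,
        (2 * quotCov a ε δ r - a * (a - 1) * r ^ (a - 2)) * (q θ (θ - r) - q θ θ))
      (C := B₁ * (c₁ * ε ^ (a + β - 1))) (fun θ hθ => by
        rw [uIoc_of_le ht.1] at hθ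
        have hθT : θ ∈ Icc 0 T := ⟨hθ.1.le, hθ.2.trans ht.2⟩
        obtain ⟨hi, hle⟩ := h1 ε δ hδ hδε θ hθ.1.le
        refine (intervalIntegral.norm_integral_le_of_norm_le hθ.1.le (ae_of_all _ fun r hr => ?_)
          (hi.const_mul B₁)).trans ?_
        · have := hq1 θ hθT (θ - r) ⟨by linarith [hr.2], by linarith [hθT.2, hr.1]⟩
          rw [sub_sub_cancel, abs_of_pos hr.1] at this
          rw [norm_mul, Real.norm_eq_abs, Real.norm_eq_abs]
          calc _ ≤ |2 * quotCov a ε δ r - a * (a - 1) * r ^ (a - 2)| * (B₁ * r ^ β) := by gcongr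
            _ = _ := by ring
        · rw [intervalIntegral.integral_const_mul]
          gcongr)
    rw [Real.norm_eq_abs, sub_zero, abs_of_nonneg ht.1] at this
    refine this.trans ?_
    calc _ ≤ B₁ * (c₁ * ε ^ (a + β - 1)) * T := by gcongr; exact ht.2
      _ = _ := by ring
  have b2 : |∫ θ in (0 : ℝ)..t,
        ((∫ r in (0 : ℝ)..θ, 2 * quotCov a ε δ r) - a * θ ^ (a - 1)) * q θ θ| ≤
      T ^ (1 - β) * c₂ * B₀ * ε ^ (a + β - 1) := by
    obtain ⟨hi, hle⟩ := h2 ε δ hδ hδε t ht.1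
    rw [← Real.norm_eq_abs]
    refine (intervalIntegral.norm_integral_le_of_norm_le ht.1 (ae_of_all _ fun θ hθ => ?_)
          (hi.const_mul (B₀ * T ^ (1 - β)))).trans ?_
    · have hθ0 : 0 < θ := hθ.1
      have hθT : θ ≤ T := hθ.2.trans ht.2
      -- As `β ≤ 1`, the weight `θ ^ (β - 1)` can be inserted at the price of `T ^ (1 - β)`.
      have h3 : 1 ≤ T ^ (1 - β) * θ ^ (β - 1) := by
        rw [show β - 1 = -(1 - β) by ring, Real.rpow_neg hθ0.le, ← div_eq_mul_inv,
          one_le_div (by positivity)]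
        exact Real.rpow_le_rpow hθ0.le hθT (by linarith)
      rw [norm_mul, Real.norm_eq_abs, Real.norm_eq_abs]
      calc _ ≤ |(∫ r in (0 : ℝ)..θ, 2 * quotCov a ε δ r) - a * θ ^ (a - 1)| * B₀ *
            (T ^ (1 - β) * θ ^ (β - 1)) := by
            refine (mul_le_mul_of_nonneg_left (hq0 θ ⟨hθ0.le, hθT⟩) (abs_nonneg _)).trans ?_
            exact le_mul_of_one_le_right (by positivity) h3
        _ = _ := by ring
    · rw [intervalIntegral.integral_const_mul]
      calc _ ≤ B₀ * T ^ (1 - β) * (c₂ * ε ^ (a + β - 1)) := by gcongr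
        _ = _ := by ring
  have hE : 0 ≤ ε ^ (a + β - 1) := by positivity
  have hTβ : 0 ≤ T ^ (1 - β) := by positivity
  calc _ ≤ T * c₁ * B₁ * ε ^ (a + β - 1) + T ^ (1 - β) * c₂ * B₀ * ε ^ (a + β - 1) :=
        (abs_add_le _ _).trans (add_le_add b1 b2)
    _ ≤ T * c₁ * (B₀ + B₁) * ε ^ (a + β - 1) + T ^ (1 - β) * c₂ * (B₀ + B₁) * ε ^ (a + β - 1) := by
        gcongr <;> linarith
    _ = _ := by ring

end Kernel

/-! ### Convergence in a Hilbert space from nearly constant inner products -/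

section Hilbert

variable {E : Type*} [NormedAddCommGroup E] [InnerProductSpace ℝ E] {f : ℝ → E} {L E₀ ρ : ℝ}

/-- In `‖f ε‖² - 2⟨f ε, f δ⟩ + ‖f δ‖²` the copies of `L` cancel and four errors remain, each at most
`E₀ ε ^ ρ`. -/
theorem norm_sub_sq_le_of_inner_near (hE₀ : 0 ≤ E₀) (hρ : 0 ≤ ρ)
    (h : ∀ ε δ, 0 < δ → δ ≤ ε → |inner ℝ (f ε) (f δ) - L| ≤ E₀ * ε ^ ρ) {ε δ : ℝ} (hδ : 0 < δ)
    (hδε : δ ≤ ε) : ‖f ε - f δ‖ ^ 2 ≤ 4 * E₀ * ε ^ ρ := by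
  have h1 := abs_le.1 (h ε ε (hδ.trans_le hδε) le_rfl)
  have h2 := abs_le.1 (h ε δ hδ hδε)
  have h3 := abs_le.1 ((h δ δ hδ le_rfl).trans
    (mul_le_mul_of_nonneg_left (Real.rpow_le_rpow hδ.le hδε hρ) hE₀))
  rw [real_inner_self_eq_norm_sq] at h1 h3
  rw [norm_sub_sq_real]
  linarith [h1.2, h2.1, h3.2]

theorem exists_tendsto_of_inner_near [CompleteSpace E] (hE₀ : 0 ≤ E₀) (hρ : 0 < ρ)
    (h : ∀ ε δ, 0 < δ → δ ≤ ε → |inner ℝ (f ε) (f δ) - L| ≤ E₀ * ε ^ ρ) :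
    ∃ x, Tendsto f (𝓝[>] 0) (𝓝 x) := by
  refine CompleteSpace.complete (Metric.cauchy_iff.2 ⟨inferInstance, fun e he => ?_⟩)
  have ht : Tendsto (fun η : ℝ => 4 * E₀ * η ^ ρ) (𝓝[>] 0) (𝓝 0) := by
    have := ((Real.continuousAt_rpow_const 0 ρ (Or.inr hρ.le)).tendsto.const_mul
      (4 * E₀)).mono_left (nhdsWithin_le_nhds (s := Ioi (0 : ℝ)))
    simpa [Real.zero_rpow hρ.ne'] using this
  obtain ⟨η, hη, hη0⟩ := ((ht.eventually (gt_mem_nhds (by positivity : 0 < e ^ 2))).and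
    self_mem_nhdsWithin).exists
  have key : ∀ ε δ, 0 < δ → δ ≤ ε → ε ≤ η → dist (f ε) (f δ) < e := fun ε δ hδ hδε hεη => by
    rw [dist_eq_norm]
    refine lt_of_pow_lt_pow_left₀ 2 he.le
      ((norm_sub_sq_le_of_inner_near hE₀ hρ.le h hδ hδε).trans_lt (lt_of_le_of_lt ?_ hη))
    exact mul_le_mul_of_nonneg_left (Real.rpow_le_rpow (hδ.le.trans hδε) hεη hρ.le) (by positivity)
  refine ⟨f '' Ioc 0 η, image_mem_map (Ioc_mem_nhdsGT hη0), ?_⟩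
  rintro _ ⟨ε, hε, rfl⟩ _ ⟨δ, hδ, rfl⟩
  rcases le_total δ ε with hle | hle
  · exact key ε δ hδ.1 hle hε.2
  · rw [dist_comm]
    exact key δ ε hε.1 hle hδ.2

theorem norm_sq_eq_of_inner_near (hρ : 0 < ρ)
    (h : ∀ ε δ, 0 < δ → δ ≤ ε → |inner ℝ (f ε) (f δ) - L| ≤ E₀ * ε ^ ρ) {x : E}
    (hx : Tendsto f (𝓝[>] 0) (𝓝 x)) : ‖x‖ ^ 2 = L := by
  refine tendsto_nhds_unique (hx.norm.pow 2) (tendsto_iff_dist_tendsto_zero.2 ?_)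
  have ht : Tendsto (fun η : ℝ => E₀ * η ^ ρ) (𝓝[>] 0) (𝓝 0) := by
    have := ((Real.continuousAt_rpow_const 0 ρ (Or.inr hρ.le)).tendsto.const_mul
      E₀).mono_left (nhdsWithin_le_nhds (s := Ioi (0 : ℝ)))
    simpa [Real.zero_rpow hρ.ne'] using this
  refine squeeze_zero' (.of_forall fun _ => dist_nonneg) ?_ ht
  filter_upwards [self_mem_nhdsWithin] with ε hε
  rw [Real.dist_eq, ← real_inner_self_eq_norm_sq]
  exact h ε ε hε le_rfl

theorem norm_sub_limit_sq_le_of_inner_near (hE₀ : 0 ≤ E₀) (hρ : 0 ≤ ρ)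
    (h : ∀ ε δ, 0 < δ → δ ≤ ε → |inner ℝ (f ε) (f δ) - L| ≤ E₀ * ε ^ ρ) {x : E}
    (hx : Tendsto f (𝓝[>] 0) (𝓝 x)) {ε : ℝ} (hε : 0 < ε) : ‖f ε - x‖ ^ 2 ≤ 4 * E₀ * ε ^ ρ := by
  refine le_of_tendsto ((hx.const_sub (f ε)).norm.pow 2) ?_
  filter_upwards [Ioc_mem_nhdsGT hε] with δ hδ
  exact norm_sub_sq_le_of_inner_near hE₀ hρ h hδ.1 hδ.2

end Hilbert

/-! ### Fubini for second-order processes -/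

section SecondOrder

variable {Ω : Type*} [MeasurableSpace Ω] {P : Measure Ω}

theorem inner_toLp_eq_integral {f g : Ω → ℝ} (hf : MemLp f 2 P) (hg : MemLp g 2 P) :
    inner ℝ (hf.toLp f) (hg.toLp g) = ∫ ω, f ω * g ω ∂P := by
  rw [L2.inner_def]
  refine integral_congr_ae ?_
  filter_upwards [hf.coeFn_toLp, hg.coeFn_toLp] with ω h1 h2
  rw [h1, h2, real_inner_eq_re_inner]
  simp [mul_comm]

theorem norm_toLp_sq_eq_integral {f : Ω → ℝ} (hf : MemLp f 2 P) :
    ‖hf.toLp f‖ ^ 2 = ∫ ω, f ω ^ 2 ∂P := by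
  rw [← real_inner_self_eq_norm_sq, inner_toLp_eq_integral]
  simp_rw [sq]

variable [IsProbabilityMeasure P]

theorem integrable_prod_of_integral_norm_le {S : Type*} [MeasurableSpace S] {ν : Measure S}
    [IsFiniteMeasure ν] {f : Ω × S → ℝ} {B : ℝ} (hf : Measurable f)
    (hi : ∀ y, Integrable (fun ω => f (ω, y)) P) (hB : ∀ y, ∫ ω, ‖f (ω, y)‖ ∂P ≤ B) :
    Integrable f (P.prod ν) := by
  refine (integrable_prod_iff' hf.aestronglyMeasurable).2 ⟨ae_of_all _ hi, ?_⟩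
  refine Integrable.of_bound (C := B) ?_ (ae_of_all _ fun y => ?_)
  · exact (hf.stronglyMeasurable.norm.integral_prod_left').aestronglyMeasurable
  · rw [Real.norm_of_nonneg (integral_nonneg fun _ => norm_nonneg _)]
    exact hB y

variable {μ : Measure ℝ} [IsFiniteMeasure μ] {X Y : ℝ → Ω → ℝ} {B : ℝ}

theorem integrable_prod_of_sq_bounded (hX : Measurable (Function.uncurry X))
    (hX2 : ∀ s, MemLp (X s) 2 P) (hXB : ∀ s, ∫ ω, X s ω ^ 2 ∂P ≤ B) :
    Integrable (fun z : Ω × ℝ => X z.2 z.1) (P.prod μ) := by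
  refine integrable_prod_of_integral_norm_le (B := (1 + B) / 2)
    (hX.comp (measurable_snd.prodMk measurable_fst))
    (fun s => (hX2 s).integrable (by norm_num)) fun s => ?_
  calc ∫ ω, ‖X s ω‖ ∂P ≤ ∫ ω, (1 + X s ω ^ 2) / 2 ∂P := by
        refine integral_mono ((hX2 s).integrable (by norm_num)).norm
          (((integrable_const _).add (hX2 s).integrable_sq).div_const _) fun ω => ?_
        simp only [Real.norm_eq_abs]
        nlinarith [sq_nonneg (|X s ω| - 1), sq_abs (X s ω)]
    _ = (1 + ∫ ω, X s ω ^ 2 ∂P) / 2 := by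
        rw [integral_div, integral_add (integrable_const _) (hX2 s).integrable_sq]
        simp
    _ ≤ _ := by linarith [hXB s]

theorem integrable_mul_prod_of_sq_bounded (hX : Measurable (Function.uncurry X))
    (hY : Measurable (Function.uncurry Y))
    (hX2 : ∀ s, MemLp (X s) 2 P) (hXB : ∀ s, ∫ ω, X s ω ^ 2 ∂P ≤ B)
    (hY2 : ∀ s, MemLp (Y s) 2 P) (hYB : ∀ s, ∫ ω, Y s ω ^ 2 ∂P ≤ B) :
    Integrable (fun z : Ω × ℝ × ℝ => X z.2.1 z.1 * Y z.2.2 z.1) (P.prod (μ.prod μ)) := by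
  refine integrable_prod_of_integral_norm_le (B := B)
    ((hX.comp ((measurable_fst.comp measurable_snd).prodMk measurable_fst)).mul
      (hY.comp ((measurable_snd.comp measurable_snd).prodMk measurable_fst)))
    (fun p => (hX2 p.1).integrable_mul (hY2 p.2)) fun p => ?_
  calc ∫ ω, ‖X p.1 ω * Y p.2 ω‖ ∂P ≤ ∫ ω, (X p.1 ω ^ 2 + Y p.2 ω ^ 2) / 2 ∂P := by
        refine integral_mono ((hX2 p.1).integrable_mul (hY2 p.2)).norm
          (((hX2 p.1).integrable_sq.add (hY2 p.2).integrable_sq).div_const _) fun ω => ?_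
        simp only [Real.norm_eq_abs, abs_mul]
        nlinarith [sq_nonneg (|X p.1 ω| - |Y p.2 ω|), sq_abs (X p.1 ω), sq_abs (Y p.2 ω)]
    _ = (∫ ω, X p.1 ω ^ 2 ∂P + ∫ ω, Y p.2 ω ^ 2 ∂P) / 2 := by
        rw [integral_div, integral_add (hX2 p.1).integrable_sq (hY2 p.2).integrable_sq]
    _ ≤ _ := by linarith [hXB p.1, hYB p.2]

/-- The square of the integral is the integral of `X s * X r` over the product measure, and this
product is jointly integrable by `2|xy| ≤ x² + y²`. -/
theorem memLp_integral_of_sq_bounded (hX : Measurable (Function.uncurry X))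
    (hX2 : ∀ s, MemLp (X s) 2 P) (hXB : ∀ s, ∫ ω, X s ω ^ 2 ∂P ≤ B) :
    MemLp (fun ω => ∫ s, X s ω ∂μ) 2 P := by
  have hm : StronglyMeasurable fun z : Ω × ℝ => X z.2 z.1 :=
    (hX.comp (measurable_snd.prodMk measurable_fst)).stronglyMeasurable
  rw [memLp_two_iff_integrable_sq hm.integral_prod_right'.aestronglyMeasurable]
  refine (integrable_mul_prod_of_sq_bounded (μ := μ) hX hX hX2 hXB hX2 hXB).integral_prod_left.congr
    (ae_of_all _ fun ω => ?_)
  simp only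
  rw [integral_prod_mul (fun s => X s ω) (fun s => X s ω), sq]

theorem integral_integral_mul_of_sq_bounded (hX : Measurable (Function.uncurry X))
    (hY : Measurable (Function.uncurry Y))
    (hX2 : ∀ s, MemLp (X s) 2 P) (hXB : ∀ s, ∫ ω, X s ω ^ 2 ∂P ≤ B)
    (hY2 : ∀ s, MemLp (Y s) 2 P) (hYB : ∀ s, ∫ ω, Y s ω ^ 2 ∂P ≤ B) :
    ∫ ω, (∫ s, X s ω ∂μ) * (∫ r, Y r ω ∂μ) ∂P = ∫ s, ∫ r, ∫ ω, X s ω * Y r ω ∂P ∂μ ∂μ := by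
  have hi := integrable_mul_prod_of_sq_bounded (μ := μ) hX hY hX2 hXB hY2 hYB
  calc _ = ∫ ω, ∫ p : ℝ × ℝ, X p.1 ω * Y p.2 ω ∂(μ.prod μ) ∂P := by
        refine integral_congr_ae (ae_of_all _ fun ω => ?_)
        exact (integral_prod_mul (fun s => X s ω) (fun s => Y s ω)).symm
    _ = ∫ p : ℝ × ℝ, ∫ ω, X p.1 ω * Y p.2 ω ∂P ∂(μ.prod μ) := integral_integral_swap hi
    _ = _ := integral_prod _ hi.integral_prod_right

end SecondOrder

/-! ### Covariances of the field -/

section Field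

variable {d : ℕ} {Ω : Type u} [MeasurableSpace Ω] {P : Measure Ω} {H γ M C₀ C₁ : ℝ}
  {Q : EuclideanSpace ℝ (Fin d) → EuclideanSpace ℝ (Fin d) → ℝ}
  {W : ℝ → EuclideanSpace ℝ (Fin d) → Ω → ℝ}

namespace IsFractionalField

theorem memLp_two (hW : IsFractionalField P H γ M C₀ C₁ Q W) (t : ℝ)
    (x : EuclideanSpace ℝ (Fin d)) : MemLp (W t x) 2 P :=
  (hW.gaussian.hasGaussianLaw_eval (t, x)).memLp_two

theorem memLp_symmQuot (hW : IsFractionalField P H γ M C₀ C₁ Q W) (ε s : ℝ)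
    (x : EuclideanSpace ℝ (Fin d)) : MemLp (symmQuot W ε s x) 2 P := by
  have := ((hW.memLp_two (s + ε) x).sub (hW.memLp_two (s - ε) x)).const_mul (2 * ε)⁻¹
  refine (memLp_congr_ae (ae_of_all _ fun ω => ?_)).1 this
  simp [symmQuot, div_eq_inv_mul]

/-- The one-variable terms `|t| ^ (2H)` and `|s| ^ (2H)` of the covariance cancel in the double
difference, leaving a function of `s - r`. -/
theorem integral_symmQuot_mul (hW : IsFractionalField P H γ M C₀ C₁ Q W) (ε δ s r : ℝ)
    (x y : EuclideanSpace ℝ (Fin d)) :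
    ∫ ω, symmQuot W ε s x ω * symmQuot W δ r y ω ∂P = quotCov (2 * H) ε δ (s - r) * Q x y := by
  have hi : ∀ t t' : ℝ, Integrable (fun ω => W t x ω * W t' y ω) P := fun t t' =>
    (hW.memLp_two t x).integrable_mul (hW.memLp_two t' y)
  have hi2 : ∀ t t₁ t₂ : ℝ,
      Integrable (fun ω => W t x ω * W t₁ y ω - W t x ω * W t₂ y ω) P := fun t t₁ t₂ =>
    (hi t t₁).sub (hi t t₂)
  have e : ∀ ω, symmQuot W ε s x ω * symmQuot W δ r y ω =
      ((W (s + ε) x ω * W (r + δ) y ω - W (s + ε) x ω * W (r - δ) y ω) -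
        (W (s - ε) x ω * W (r + δ) y ω - W (s - ε) x ω * W (r - δ) y ω)) * (4 * ε * δ)⁻¹ :=
    fun ω => by unfold symmQuot; ring
  simp_rw [e]
  rw [integral_mul_const, integral_sub (hi2 _ _ _) (hi2 _ _ _),
    integral_sub (hi _ _) (hi _ _), integral_sub (hi _ _) (hi _ _)]
  simp_rw [hW.covariance]
  unfold fbmCov quotCov
  rw [show s + ε - (r + δ) = s - r + ε - δ by ring, show s + ε - (r - δ) = s - r + ε + δ by ring,
    show s - ε - (r + δ) = s - r - ε - δ by ring, show s - ε - (r - δ) = s - r - ε + δ by ring]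
  ring

/-- At time `1` the temporal covariance is `1`, so `Q` is itself a covariance. Its symmetry and its
nonnegativity on the diagonal follow; the latter turns the one-sided bound on `Q` into a bound on
`|Q x x|`. -/
theorem integral_one_mul_one (hW : IsFractionalField P H γ M C₀ C₁ Q W) (hH : 0 < H)
    (x y : EuclideanSpace ℝ (Fin d)) : ∫ ω, W 1 x ω * W 1 y ω ∂P = Q x y := by
  rw [hW.covariance]
  simp [fbmCov, Real.zero_rpow (by linarith : 2 * H ≠ 0)]

theorem spatial_symm (hW : IsFractionalField P H γ M C₀ C₁ Q W) (hH : 0 < H)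
    (x y : EuclideanSpace ℝ (Fin d)) : Q x y = Q y x := by
  rw [← hW.integral_one_mul_one hH, ← hW.integral_one_mul_one hH]
  simp_rw [mul_comm]

theorem abs_diag_le (hW : IsFractionalField P H γ M C₀ C₁ Q W) (hH : 0 < H) {K : ℝ} (hK : 0 < K)
    {x : EuclideanSpace ℝ (Fin d)} (hx : ‖x‖ ≤ K) : |Q x x| ≤ C₀ * (1 + K) ^ M := by
  rw [abs_of_nonneg]
  · exact hW.bound K hK x x hx hx
  · rw [← hW.integral_one_mul_one hH]
    exact integral_nonneg fun ω => mul_self_nonneg _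

theorem continuous_spatial (hW : IsFractionalField P H γ M C₀ C₁ Q W) (hγ : 0 < γ) {K : ℝ}
    (hK : 0 < K) {ψ : ℝ → EuclideanSpace ℝ (Fin d)} (hψ : Continuous ψ) (hψK : ∀ s, ‖ψ s‖ ≤ K) :
    Continuous (Function.uncurry fun s r => Q (ψ s) (ψ r)) := by
  refine continuous_iff_continuousAt.2 fun p => tendsto_iff_dist_tendsto_zero.2 ?_
  have hc : Continuous fun z : ℝ × ℝ => C₁ * (1 + K) ^ M *
      (‖ψ z.1 - ψ p.1‖ ^ γ + ‖ψ z.2 - ψ p.2‖ ^ γ) :=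
    continuous_const.mul ((Continuous.rpow_const (by fun_prop) fun _ => Or.inr hγ.le).add
      (Continuous.rpow_const (by fun_prop) fun _ => Or.inr hγ.le))
  have ht := hc.tendsto p
  simp only [sub_self, norm_zero, Real.zero_rpow hγ.ne', add_zero, mul_zero] at ht
  refine squeeze_zero (fun _ => dist_nonneg) (fun z => ?_) ht
  exact hW.holder K hK _ _ _ _ (hψK _) (hψK _) (hψK _) (hψK _)

theorem measurable_symmQuot (hW : IsFractionalField P H γ M C₀ C₁ Q W)
    {ψ : ℝ → EuclideanSpace ℝ (Fin d)} (hψ : Continuous ψ) (ε : ℝ) :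
    Measurable (Function.uncurry fun s ω => symmQuot W ε s (ψ s) ω) := by
  have h : ∀ c : ℝ, Measurable fun p : ℝ × Ω => W (p.1 + c) (ψ p.1) p.2 := fun c =>
    hW.measurable.comp (((measurable_fst.add_const c).prodMk
      (hψ.measurable.comp measurable_fst)).prodMk measurable_snd)
  have h2 := h (-ε)
  simp only [← sub_eq_add_neg] at h2
  exact ((h ε).sub h2).div_const _

end IsFractionalField

/-! ### Approximations along a Hölder path -/

section Path

variable {T : ℝ} {α : ℝ≥0} {φ : ℝ → EuclideanSpace ℝ (Fin d)}

/-- The continuous extension of a path on `[0, T]` that is constant outside of `[0, T]`. -/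
noncomputable def extendPath (hT : 0 ≤ T) (φ : ℝ → EuclideanSpace ℝ (Fin d)) :
    ℝ → EuclideanSpace ℝ (Fin d) :=
  IccExtend hT ((Icc (0 : ℝ) T).domRestrict φ)

theorem extendPath_eq (hT : 0 ≤ T) {s : ℝ} (hs : s ∈ Icc 0 T) : extendPath hT φ s = φ s :=
  IccExtend_of_mem hT _ hs

theorem continuous_extendPath (hT : 0 ≤ T) (hα : 0 < α) (hφ : HolderOnInterval α T φ) :
    Continuous (extendPath hT φ) :=
  (hφ.holderWith.continuous hα).Icc_extend'

theorem norm_extendPath_le (hT : 0 ≤ T) (hα : 0 < α) (hφ : HolderOnInterval α T φ) (s : ℝ) :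
    ‖extendPath hT φ s‖ ≤ supNormOn T φ := by
  have hc : Continuous fun s : Icc (0 : ℝ) T => ‖φ s‖ := (hφ.holderWith.continuous hα).norm
  exact le_ciSup (isCompact_range hc).bddAbove (projIcc 0 T hT s)

theorem norm_sub_le_of_holderOnInterval (hφ : HolderOnInterval α T φ) {s r : ℝ}
    (hs : s ∈ Icc 0 T) (hr : r ∈ Icc 0 T) :
    ‖φ s - φ r‖ ≤ holderSeminormOn α T φ * |s - r| ^ (α : ℝ) := by
  have := hφ.holderWith.dist_le ⟨s, hs⟩ ⟨r, hr⟩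
  rw [dist_eq_norm, Subtype.dist_eq, Real.dist_eq] at this
  exact this

theorem supNormOn_nonneg (T : ℝ) (φ : ℝ → EuclideanSpace ℝ (Fin d)) : 0 ≤ supNormOn T φ :=
  Real.iSup_nonneg fun _ => norm_nonneg _

theorem holderSeminormOn_nonneg (α : ℝ≥0) (T : ℝ) (φ : ℝ → EuclideanSpace ℝ (Fin d)) :
    0 ≤ holderSeminormOn α T φ :=
  NNReal.coe_nonneg _

theorem IsFractionalField.abs_spatial_sub_diag_le (hW : IsFractionalField P H γ M C₀ C₁ Q W)
    (hγ : 0 < γ) (hC₁ : 0 ≤ C₁) (hT : 0 ≤ T) (hα : 0 < α) (hφ : HolderOnInterval α T φ) {β : ℝ}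
    (hβ0 : 0 ≤ β) (hβ : β ≤ γ * α) {s r : ℝ} (hs : s ∈ Icc 0 T) (hr : r ∈ Icc 0 T) :
    |Q (extendPath hT φ s) (extendPath hT φ r) - Q (extendPath hT φ s) (extendPath hT φ s)| ≤
      C₁ * (2 + supNormOn T φ) ^ M * holderSeminormOn α T φ ^ γ * T ^ (γ * α - β) *
        |s - r| ^ β := by
  have hb := fun s => norm_extendPath_le hT hα hφ s
  have h0 := supNormOn_nonneg T φ
  have hN := holderSeminormOn_nonneg α T φ
  -- The radius must be positive even for the zero path, hence `1 + supNormOn T φ`, which makes the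
  -- growth factor `(2 + supNormOn T φ) ^ M`.
  have h1 := hW.holder (1 + supNormOn T φ) (by linarith) _ _ _ _
    ((hb s).trans (by linarith)) ((hb r).trans (by linarith))
    ((hb s).trans (by linarith)) ((hb s).trans (by linarith))
  refine h1.trans ?_
  rw [sub_self, norm_zero, Real.zero_rpow hγ.ne', zero_add, ← add_assoc, one_add_one_eq_two,
    extendPath_eq hT hs, extendPath_eq hT hr]
  have h2 : ‖φ r - φ s‖ ^ γ ≤
      holderSeminormOn α T φ ^ γ * (T ^ (γ * α - β) * |s - r| ^ β) := by
    calc ‖φ r - φ s‖ ^ γ ≤ (holderSeminormOn α T φ * |s - r| ^ (α : ℝ)) ^ γ := by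
          rw [norm_sub_rev]
          exact Real.rpow_le_rpow (norm_nonneg _) (norm_sub_le_of_holderOnInterval hφ hs hr) hγ.le
      _ = holderSeminormOn α T φ ^ γ * (|s - r| ^ (γ * α - β) * |s - r| ^ β) := by
          rw [Real.mul_rpow hN (by positivity), ← Real.rpow_mul (abs_nonneg _),
            ← Real.rpow_add_of_nonneg (abs_nonneg _) (by linarith) hβ0, sub_add_cancel, mul_comm γ]
      _ ≤ _ := by
          have : |s - r| ≤ T := abs_le.2 ⟨by linarith [hs.1, hr.2], by linarith [hs.2, hr.1]⟩
          have := Real.rpow_le_rpow (abs_nonneg _) this (sub_nonneg.2 hβ)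
          gcongr
  calc _ ≤ C₁ * (2 + supNormOn T φ) ^ M *
        (holderSeminormOn α T φ ^ γ * (T ^ (γ * α - β) * |s - r| ^ β)) := by gcongr
    _ = _ := by ring

theorem symmApprox_eq_integral_extendPath {Ω : Type*}
    {W : ℝ → EuclideanSpace ℝ (Fin d) → Ω → ℝ} (hT : 0 ≤ T) {t : ℝ} (ht : t ∈ Icc 0 T)
    (ε : ℝ) (ω : Ω) : symmApprox W φ ε t ω = ∫ s in Ioc 0 t, symmQuot W ε s (extendPath hT φ s) ω := by
  rw [symmApprox, intervalIntegral.integral_of_le ht.1]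
  refine setIntegral_congr_fun measurableSet_Ioc fun s hs => ?_
  rw [extendPath_eq hT ⟨hs.1.le, hs.2.trans ht.2⟩]

/-- `I` is the nonlinear integral if and only if it is the `L²` limit of the approximations. -/
theorem isNonlinearIntegral_iff_tendsto {t : ℝ} (hA : ∀ ε, MemLp (symmApprox W φ ε t) 2 P)
    {I : Ω → ℝ} (hI : MemLp I 2 P) :
    IsNonlinearIntegral P W φ t I ↔
      Tendsto (fun ε => (hA ε).toLp (symmApprox W φ ε t)) (𝓝[>] 0) (𝓝 (hI.toLp I)) := by
  rw [Lp.tendsto_Lp_iff_tendsto_eLpNorm'']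
  exact ⟨fun h => h.2.2, fun h => ⟨hI, .of_forall hA, h⟩⟩

/-- The bound may blow up as `ε ↓ 0`; its uniformity in `s` for fixed `ε` is all that Fubini
requires. -/
theorem IsFractionalField.integral_symmQuot_sq_le (hW : IsFractionalField P H γ M C₀ C₁ Q W)
    (hH : 0 < H) (hT : 0 ≤ T) (hα : 0 < α) (hφ : HolderOnInterval α T φ) (ε s : ℝ) :
    ∫ ω, symmQuot W ε s (extendPath hT φ s) ω ^ 2 ∂P ≤
      |quotCov (2 * H) ε ε 0| * (C₀ * (2 + supNormOn T φ) ^ M) := by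
  simp_rw [sq]
  rw [hW.integral_symmQuot_mul, sub_self]
  refine (le_abs_self _).trans ?_
  rw [abs_mul]
  refine mul_le_mul_of_nonneg_left ?_ (abs_nonneg _)
  have h0 := supNormOn_nonneg T φ
  have := hW.abs_diag_le hH (K := 1 + supNormOn T φ) (by linarith)
    ((norm_extendPath_le hT hα hφ s).trans (by linarith))
  rwa [← add_assoc, one_add_one_eq_two] at this

variable [IsProbabilityMeasure P]

theorem IsFractionalField.ae_intervalIntegrable_symmQuot
    (hW : IsFractionalField P H γ M C₀ C₁ Q W) (hH : 0 < H) (hT : 0 ≤ T) (hα : 0 < α)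
    (hφ : HolderOnInterval α T φ) {t : ℝ} (ht : t ∈ Icc 0 T) (ε : ℝ) :
    ∀ᵐ ω ∂P, IntervalIntegrable (fun s => symmQuot W ε s (φ s) ω) volume 0 t := by
  have hi := integrable_prod_of_sq_bounded (μ := volume.restrict (Ioc 0 t))
    (hW.measurable_symmQuot (continuous_extendPath hT hα hφ) ε)
    (fun s => hW.memLp_symmQuot ε s _) (hW.integral_symmQuot_sq_le hH hT hα hφ ε)
  filter_upwards [hi.prod_right_ae] with ω hω
  rw [intervalIntegrable_iff_integrableOn_Ioc_of_le ht.1]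
  refine IntegrableOn.congr_fun (hω : IntegrableOn _ _ _) (fun s hs => ?_) measurableSet_Ioc
  rw [extendPath_eq hT ⟨hs.1.le, hs.2.trans ht.2⟩]

theorem IsFractionalField.memLp_symmApprox
    (hW : IsFractionalField P H γ M C₀ C₁ Q W) (hH : 0 < H) (hT : 0 ≤ T) (hα : 0 < α)
    (hφ : HolderOnInterval α T φ) {t : ℝ} (ht : t ∈ Icc 0 T) (ε : ℝ) :
    MemLp (symmApprox W φ ε t) 2 P := by
  rw [show symmApprox W φ ε t = _ from funext (symmApprox_eq_integral_extendPath hT ht ε)]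
  exact memLp_integral_of_sq_bounded (hW.measurable_symmQuot (continuous_extendPath hT hα hφ) ε)
    (fun s => hW.memLp_symmQuot ε s _) (hW.integral_symmQuot_sq_le hH hT hα hφ ε)

theorem IsFractionalField.integral_symmApprox_mul
    (hW : IsFractionalField P H γ M C₀ C₁ Q W) (hH : 0 < H) (hT : 0 ≤ T) (hα : 0 < α)
    (hφ : HolderOnInterval α T φ) {t : ℝ} (ht : t ∈ Icc 0 T) (ε δ : ℝ) :
    ∫ ω, symmApprox W φ ε t ω * symmApprox W φ δ t ω ∂P =
      ∫ s in (0 : ℝ)..t, ∫ r in (0 : ℝ)..t, quotCov (2 * H) ε δ (s - r) *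
        Q (extendPath hT φ s) (extendPath hT φ r) := by
  have hψ := continuous_extendPath hT hα hφ
  simp_rw [symmApprox_eq_integral_extendPath hT ht]
  rw [integral_integral_mul_of_sq_bounded (hW.measurable_symmQuot hψ ε)
    (hW.measurable_symmQuot hψ δ) (fun s => hW.memLp_symmQuot ε s _)
    (fun s => (hW.integral_symmQuot_sq_le hH hT hα hφ ε s).trans (le_max_left _ _))
    (fun s => hW.memLp_symmQuot δ s _)
    (fun s => (hW.integral_symmQuot_sq_le hH hT hα hφ δ s).trans (le_max_right _ _))]
  simp_rw [hW.integral_symmQuot_mul, intervalIntegral.integral_of_le ht.1]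

end Path

end Field

/-! ### The uniform covariance estimate and the main theorem -/

theorem exists_abs_integral_symmApprox_mul_sub_le {H γ T β : ℝ} {α : ℝ≥0} (hH0 : 0 < H)
    (hH : H < 1 / 2) (hγ0 : 0 < γ) (hT : 0 < T) (hα : 0 < α) (hβ1 : β ≤ 1) (hβ : 1 < 2 * H + β)
    (hβα : β ≤ γ * α) :
    ∃ c : ℝ, 0 ≤ c ∧ ∀ {C₀ C₁ M : ℝ} {d : ℕ} {Ω : Type u} [MeasurableSpace Ω] {P : Measure Ω}
      [IsProbabilityMeasure P] {Q : EuclideanSpace ℝ (Fin d) → EuclideanSpace ℝ (Fin d) → ℝ}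
      {W : ℝ → EuclideanSpace ℝ (Fin d) → Ω → ℝ} {φ : ℝ → EuclideanSpace ℝ (Fin d)},
      0 ≤ C₀ → 0 ≤ C₁ → IsFractionalField P H γ M C₀ C₁ Q W → HolderOnInterval α T φ →
      ∀ t ∈ Icc 0 T, ∀ ε δ : ℝ, 0 < δ → δ ≤ ε →
        |∫ ω, symmApprox W φ ε t ω * symmApprox W φ δ t ω ∂P - nonlinearVariance (2 * H)
          (fun s r => Q (extendPath hT.le φ s) (extendPath hT.le φ r)) t| ≤
          c * (C₀ + C₁) * (1 + supNormOn T φ) ^ M * (1 + holderSeminormOn α T φ ^ γ) *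
            ε ^ (2 * H + β - 1) := by
  obtain ⟨c, hc, h⟩ := exists_abs_integral_quotCov_sub_le (a := 2 * H) (by linarith)
    (by linarith) hβ1 hβ hT
  refine ⟨c * (4 * (1 + T ^ (γ * α - β))), by positivity, ?_⟩
  intro C₀ C₁ M d Ω _ P _ Q W φ hC₀ hC₁ hW hφ t ht ε δ hδ hδε
  have hε : 0 < ε := hδ.trans_le hδε
  have h0 := supNormOn_nonneg T φ
  have hN := holderSeminormOn_nonneg α T φ
  have hψ := continuous_extendPath hT.le hα hφ
  have hK : ∀ s, ‖extendPath hT.le φ s‖ ≤ 1 + supNormOn T φ := fun s =>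
    (norm_extendPath_le hT.le hα hφ s).trans (by linarith)
  -- The growth condition `M < 2` gives `2 ^ M ≤ 4`, so the constant does not depend on `M`.
  have hM : (2 + supNormOn T φ) ^ M ≤ 4 * (1 + supNormOn T φ) ^ M := by
    rcases le_total M 0 with hM | hM
    · refine (Real.rpow_le_rpow_of_nonpos (by linarith) (by linarith :
        1 + supNormOn T φ ≤ 2 + supNormOn T φ) hM).trans ?_
      have : 0 ≤ (1 + supNormOn T φ) ^ M := by positivity
      linarith
    · calc (2 + supNormOn T φ) ^ M ≤ (2 * (1 + supNormOn T φ)) ^ M :=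
            Real.rpow_le_rpow (by linarith) (by linarith) hM
        _ = 2 ^ M * (1 + supNormOn T φ) ^ M := Real.mul_rpow (by norm_num) (by linarith)
        _ ≤ 2 ^ (2 : ℝ) * (1 + supNormOn T φ) ^ M := by
            gcongr
            · norm_num
            · exact hW.growth_lt.le
        _ = _ := by norm_num
  rw [hW.integral_symmApprox_mul hH0 hT.le hα hφ ht]
  refine (h _ (C₀ * (2 + supNormOn T φ) ^ M)
    (C₁ * (2 + supNormOn T φ) ^ M * holderSeminormOn α T φ ^ γ * T ^ (γ * α - β))
    (hW.continuous_spatial hγ0 (by linarith) hψ hK) (fun s r => hW.spatial_symm hH0 _ _)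
    (by positivity) (by positivity) (fun s _ => ?_)
    (fun s hs r hr => hW.abs_spatial_sub_diag_le hγ0 hC₁ hT.le hα hφ (by linarith) hβα hs hr)
    ε δ hδ hδε t ht).trans ?_
  · have := hW.abs_diag_le hH0 (K := 1 + supNormOn T φ) (by linarith) (hK s)
    rwa [← add_assoc, one_add_one_eq_two] at this
  · set N := holderSeminormOn α T φ ^ γ
    set U := T ^ (γ * α - β)
    set S := (2 + supNormOn T φ) ^ M
    have hN' : 0 ≤ N := by positivity
    have hU : 0 ≤ U := by positivity
    have hS : 0 ≤ S := by positivity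
    have e1 : C₀ * S + C₁ * S * N * U ≤ (C₀ + C₁) * S * ((1 + U) * (1 + N)) := by
      have : (C₀ + C₁) * S * ((1 + U) * (1 + N)) - (C₀ * S + C₁ * S * N * U) =
        C₁ * S * (1 + U + N) + C₀ * S * (U + N + U * N) := by ring
      have h2 : 0 ≤ C₁ * S * (1 + U + N) + C₀ * S * (U + N + U * N) := by positivity
      linarith
    calc _ ≤ c * ((C₀ + C₁) * S * ((1 + U) * (1 + N))) * ε ^ (2 * H + β - 1) := by gcongr
      _ ≤ c * ((C₀ + C₁) * (4 * (1 + supNormOn T φ) ^ M) * ((1 + U) * (1 + N))) *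
          ε ^ (2 * H + β - 1) := by gcongr
      _ = _ := by ring

theorem mainTheorem2 (H γ T : ℝ) (α : ℝ≥0) (hH0 : 0 < H) (hH : H < 1 / 2) (hγ0 : 0 < γ)
    (hγ1 : γ ≤ 1) (hT : 0 < T) (hα1 : α ≤ 1) (hα : 1 - 2 * H < γ * (α : ℝ)) :
    (∀ (C₀ C₁ M : ℝ) (d : ℕ) (Ω : Type u) [MeasurableSpace Ω] (P : Measure Ω)
        [IsProbabilityMeasure P]
        (Q : EuclideanSpace ℝ (Fin d) → EuclideanSpace ℝ (Fin d) → ℝ)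
        (W : ℝ → EuclideanSpace ℝ (Fin d) → Ω → ℝ) (φ : ℝ → EuclideanSpace ℝ (Fin d)),
        0 < C₀ → 0 < C₁ → IsFractionalField P H γ M C₀ C₁ Q W → HolderOnInterval α T φ →
        ∀ t ∈ Icc (0 : ℝ) T,
          -- the symmetric approximations are well defined and square integrable
          (∀ ε : ℝ, 0 < ε →
            (∀ᵐ ω ∂P, IntervalIntegrable (fun s => symmQuot W ε s (φ s) ω) volume 0 t) ∧
            MemLp (symmApprox W φ ε t) 2 P) ∧
          -- the nonlinear integral exists
          (∃ I : Ω → ℝ, IsNonlinearIntegral P W φ t I) ∧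
          -- the integrals in the variance formula converge
          IntervalIntegrable (fun θ : ℝ => θ ^ (2 * H - 1) * Q (φ θ) (φ θ)) volume 0 t ∧
          (∀ θ ∈ Icc (0 : ℝ) t, IntervalIntegrable
            (fun r : ℝ => r ^ (2 * H - 2) * (Q (φ θ) (φ (θ - r)) - Q (φ θ) (φ θ))) volume 0 θ) ∧
          IntervalIntegrable (fun θ : ℝ => ∫ r in (0 : ℝ)..θ,
            r ^ (2 * H - 2) * (Q (φ θ) (φ (θ - r)) - Q (φ θ) (φ θ))) volume 0 t ∧
          -- the variance formula
          (∀ I : Ω → ℝ, IsNonlinearIntegral P W φ t I →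
            ∫ ω, I ω ^ 2 ∂P =
              2 * H * (∫ θ in (0 : ℝ)..t, θ ^ (2 * H - 1) * Q (φ θ) (φ θ)) +
              2 * H * (2 * H - 1) * (∫ θ in (0 : ℝ)..t, ∫ r in (0 : ℝ)..θ,
                r ^ (2 * H - 2) * (Q (φ θ) (φ (θ - r)) - Q (φ θ) (φ θ))))) ∧
    -- the rate of convergence
    (∀ α' C₀ C₁ : ℝ, (1 - 2 * H) / γ < α' → α' < α → 0 < C₀ → 0 < C₁ →
      ∃ C : ℝ, ∀ (M : ℝ) (d : ℕ) (Ω : Type u) [MeasurableSpace Ω] (P : Measure Ω)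
        [IsProbabilityMeasure P]
        (Q : EuclideanSpace ℝ (Fin d) → EuclideanSpace ℝ (Fin d) → ℝ)
        (W : ℝ → EuclideanSpace ℝ (Fin d) → Ω → ℝ) (φ : ℝ → EuclideanSpace ℝ (Fin d)),
        IsFractionalField P H γ M C₀ C₁ Q W → HolderOnInterval α T φ →
        ∀ ε : ℝ, 0 < ε → ∀ t ∈ Icc (0 : ℝ) T, ∀ I : Ω → ℝ, IsNonlinearIntegral P W φ t I →
          ∫ ω, |symmApprox W φ ε t ω - I ω| ^ 2 ∂P ≤
            C * (1 + supNormOn T φ) ^ M * (1 + holderSeminormOn α T φ ^ γ) *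
              ε ^ (2 * H + γ * α' - 1)) := by
  have hα0 : 0 < α := by
    rcases eq_zero_or_pos α with rfl | h
    · simp at hα; linarith
    · exact h
  have hα1' : (α : ℝ) ≤ 1 := by exact_mod_cast hα1
  have hγα : γ * α ≤ 1 := by nlinarith [α.coe_nonneg]
  constructor
  · intro C₀ C₁ M d Ω _ P _ Q W φ hC₀ hC₁ hW hφ t ht
    -- Existence and the variance formula take `β = γα`, with no loss of Hölder exponent.
    obtain ⟨c, hc, h⟩ := exists_abs_integral_symmApprox_mul_sub_le.{u} hH0 hH hγ0 hT hα0 hγα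
      (by linarith) le_rfl
    -- This holds for every real `ε`; at `ε = 0` the quotient is `0` by convention. The
    -- approximations thus define a map from all of `ℝ` to `L²`.
    have hA := hW.memLp_symmApprox hH0 hT.le hα0 hφ ht
    have h0 := supNormOn_nonneg T φ
    have hN := holderSeminormOn_nonneg α T φ
    have hρ : 0 < 2 * H + γ * α - 1 := by linarith
    have hin := h hC₀.le hC₁.le hW hφ t ht
    simp_rw [← inner_toLp_eq_integral (hA _) (hA _)] at hin
    have hK : ∀ s, ‖extendPath hT.le φ s‖ ≤ 1 + supNormOn T φ := fun s =>
      (norm_extendPath_le hT.le hα0 hφ s).trans (by linarith)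
    have hq := hW.continuous_spatial hγ0 (by linarith) (continuous_extendPath hT.le hα0 hφ) hK
    have hq1 := fun (s) (hs : s ∈ Icc 0 T) (r) (hr : r ∈ Icc 0 T) =>
      hW.abs_spatial_sub_diag_le hγ0 hC₁.le hT.le hα0 hφ (by positivity) le_rfl hs hr
    have hext : ∀ s ∈ Icc 0 t, extendPath hT.le φ s = φ s := fun s hs =>
      extendPath_eq hT.le ⟨hs.1, hs.2.trans ht.2⟩
    have ediag : EqOn (fun θ : ℝ => θ ^ (2 * H - 1) *
        Q (extendPath hT.le φ θ) (extendPath hT.le φ θ))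
        (fun θ : ℝ => θ ^ (2 * H - 1) * Q (φ θ) (φ θ)) (uIcc 0 t) := fun θ hθ => by
      rw [uIcc_of_le ht.1] at hθ
      simp only [hext θ hθ]
    have einner : ∀ θ ∈ Icc 0 t, EqOn (fun r : ℝ => r ^ (2 * H - 2) *
        (Q (extendPath hT.le φ θ) (extendPath hT.le φ (θ - r)) -
          Q (extendPath hT.le φ θ) (extendPath hT.le φ θ)))
        (fun r : ℝ => r ^ (2 * H - 2) * (Q (φ θ) (φ (θ - r)) - Q (φ θ) (φ θ))) (uIcc 0 θ) :=
      fun θ hθ r hr => by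
        rw [uIcc_of_le hθ.1] at hr
        simp only [hext θ hθ, hext (θ - r) ⟨by linarith [hr.2], by linarith [hr.1, hθ.2]⟩]
    have eouter : EqOn (fun θ : ℝ => ∫ r in (0 : ℝ)..θ, r ^ (2 * H - 2) *
        (Q (extendPath hT.le φ θ) (extendPath hT.le φ (θ - r)) -
          Q (extendPath hT.le φ θ) (extendPath hT.le φ θ)))
        (fun θ : ℝ => ∫ r in (0 : ℝ)..θ, r ^ (2 * H - 2) *
          (Q (φ θ) (φ (θ - r)) - Q (φ θ) (φ θ))) (uIcc 0 t) := fun θ hθ => by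
      rw [uIcc_of_le ht.1] at hθ
      exact intervalIntegral.integral_congr (einner θ hθ)
    refine ⟨fun ε _ => ⟨hW.ae_intervalIntegrable_symmQuot hH0 hT.le hα0 hφ ht ε, hA ε⟩,
      ?_, ?_, ?_, ?_, ?_⟩
    · obtain ⟨x, hx⟩ := exists_tendsto_of_inner_near (f := fun ε => (hA ε).toLp) (by positivity)
        hρ hin
      refine ⟨x, (isNonlinearIntegral_iff_tendsto hA (Lp.memLp x)).2 ?_⟩
      rwa [Lp.toLp_coeFn]
    · exact (intervalIntegrable_rpow_mul_diag (by linarith) hq t).congr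
        fun θ hθ => ediag (uIoc_subset_uIcc hθ)
    · intro θ hθ
      exact (intervalIntegrable_rpow_mul_sub (by linarith) hq hq1 ⟨hθ.1, hθ.2.trans ht.2⟩).congr
        fun r hr => einner θ hθ (uIoc_subset_uIcc hr)
    · exact (intervalIntegrable_integral_rpow_mul_sub (by linarith) hq hq1 (by positivity)
        ht).congr fun θ hθ => eouter (uIoc_subset_uIcc hθ)
    · intro I hI
      have hv := norm_sq_eq_of_inner_near (f := fun ε => (hA ε).toLp) hρ hin
        ((isNonlinearIntegral_iff_tendsto hA hI.1).1 hI)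
      rw [← norm_toLp_sq_eq_integral hI.1, hv, nonlinearVariance,
        intervalIntegral.integral_congr ediag, intervalIntegral.integral_congr eouter]
  · intro α' C₀ C₁ hα'0 hα'1 hC₀ hC₁
    rw [div_lt_iff₀ hγ0, mul_comm] at hα'0
    have hle : γ * α' ≤ γ * α := mul_le_mul_of_nonneg_left hα'1.le hγ0.le
    -- Here `β = γα'`, so that the exponent `2H + β - 1` is the required rate.
    obtain ⟨c, hc, h⟩ := exists_abs_integral_symmApprox_mul_sub_le.{u} hH0 hH hγ0 hT hα0
      (hle.trans hγα) (by linarith) hle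
    refine ⟨4 * (c * (C₀ + C₁)), ?_⟩
    intro M d Ω _ P _ Q W φ hW hφ ε hε t ht I hI
    have hA := hW.memLp_symmApprox hH0 hT.le hα0 hφ ht
    have h0 := supNormOn_nonneg T φ
    have hN := holderSeminormOn_nonneg α T φ
    have hin := h hC₀.le hC₁.le hW hφ t ht
    simp_rw [← inner_toLp_eq_integral (hA _) (hA _)] at hin
    have hr := norm_sub_limit_sq_le_of_inner_near (f := fun ε => (hA ε).toLp) (by positivity)
      (by linarith) hin ((isNonlinearIntegral_iff_tendsto hA hI.1).1 hI) hε
    rw [← MemLp.toLp_sub, norm_toLp_sq_eq_integral] at hr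
    simp_rw [sq_abs]
    refine hr.trans (le_of_eq ?_)
    ring
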